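/- **Setting.** A tracial $\mathrm{W}^*$-algebra $(\mathcal M,\tau)$ is a von Neumann algebra with a faithful normal tracial state; $\|a\|_2=\tau(a^*a)^{1/2}$, and $L^2(\mathcal M)$ is the completion for $\|\cdot\|_2$. For a $\mathrm{W}^*$-subalgebra $\mathcal P\subseteq\mathcal M$, $E_{\mathcal P}$ is the trace-preserving conditional expectation of $\mathcal M$ onto $\mathcal P$. On $M_n(\mathbb C)$ the trace is $\tau_n=\frac1n\mathrm{Tr}$. For an index set $I$, $\mathbb C\langle t_i:i\in I\rangle$ is the $*$-algebra of non-commutative polynomials in self-adjoint variables $t_i$. *Function spaces.* For $\mathbf R\in(0,\infty)^I$ let $\Sigma_{\mathbf R}$ be the set of unital positive tracial linear functionals $\lambda$ on $\mathbb C\langle t_i:i\in I\rangle$ with $|\lambda(t_{i(1)}\cdots t_{i(\ell)})|\le R_{i(1)}\cdots R_{i(\ell)}$ for all $\ell$ and $i(1),\dots,i(\ell)$, with the topology of pointwise convergence. For a self-adjoint tuple $\mathbf x\in\mathcal M_{sa}^I$ with $\|x_i\|\le R_i$, let $\lambda_{\mathbf x}(p)=\tau(p(\mathbf x))$, and for $\phi\otimes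 p\in\mathcal A_{\mathbf R}=C(\Sigma_{\mathbf R})\otimes\mathbb C\langle t_i:i\in I\rangle$ let $(\phi\otimes p)(\mathbf x)=\phi(\lambda_{\mathbf x})p(\mathbf x)$, extended linearly. $\mathcal F_{\mathbf R,2}$ is the separated completion of $\mathcal A_{\mathbf R}$ for the seminorm $\|f\|_{\mathbf R,2}=\sup\|f(\mathbf x)\|_2$, the supremum being over all $(\mathcal M,\tau)$ and all $\mathbf x\in\mathcal M_{sa}^I$ with $\|x_i\|\le R_i$; evaluation extends to $f\mapsto f(\mathbf x)\in L^2(\mathcal M)$. For $\mathbf R'\in(0,\infty)^{I'}$, $\mathcal F_{\mathbf R,\mathbf R'}$ is the set of tuples $\mathbf f=(f_i)_{i\in I'}$ in $\mathcal F_{\mathbf R,2}$ such that for every $i\in I'$, every $(\mathcal M,\tau)$ and every such $\mathbf x$, $f_i(\mathbf x)$ is a self-adjoint element of $\mathcal M$ with $\|f_i(\mathbf x)\|\le R_i'$. Put $\mathbf f(\mathbf x)=(f_i(\mathbf x))_{i\in I'}$. *Random matrix models.* Let $n(k)\ge1$ be integers with $n(k)\to\infty$. Borel probability measures $\mu^{(k)}$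 on $M_{n(k)}(\mathbb C)_{sa}^I$ (product topology), $k\in\mathbb N$, are said to satisfy (1)–(4) with respect to $\mathcal P\subseteq\mathcal M$, a tuple $\mathbf x\in\mathcal M_{sa}^I$ of generators of $\mathcal M$, and $\mathbf R$, if 1. $\mu^{(k)}$ is supported on $\{\mathbf A:\|A_i\|\le R_i\text{ for all }i\}$, for every $k$; 2. for every $p\in\mathbb C\langle t_i:i\in I\rangle$ and $\varepsilon>0$, $\mu^{(k)}\{\mathbf A:|\tau_{n(k)}(p(\mathbf A))-\tau(p(\mathbf x))|\ge\varepsilon\}\to0$; 3. for every finite $F\subseteq I$ and $\varepsilon>0$, $\limsup_{k\to\infty}\frac1{n(k)^2}\log\alpha_{\mu^{(k)}}(F,\varepsilon)<0$, where $\alpha_\mu(F,\varepsilon)=\sup\{\mu(N_{F,\varepsilon}(\Omega)^c):\Omega\text{ Borel},\ \mu(\Omega)\ge\frac12\}$ and $N_{F,\varepsilon}(\Omega)=\{\mathbf B:\exists\mathbf A\in\Omega\ \forall i\in F\ \|A_i-B_i\|_2<\varepsilon\}$; 4. for every $p\in\mathbb C\langle t_i:i\in I\rangle$, $\bigl\|\int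 p(\mathbf A)\,d\mu^{(k)}(\mathbf A)\bigr\|_2\to\|E_{\mathcal P}[p(\mathbf x)]\|_2$. If $\mu$ is a probability measure on $M_n(\mathbb C)_{sa}^I$ supported on $\{\mathbf A:\|A_i\|\le R_i\}$ and $\mathbf f\in\mathcal F_{\mathbf R,\mathbf R'}$, then $\mathbf f_*\mu$ denotes the push-forward of $\mu$ under $\mathbf A\mapsto\mathbf f(\mathbf A)$. **Proposition.** Let $(\mathcal M,\tau)$ be a tracial $\mathrm{W}^*$-algebra, $\mathcal P\subseteq\mathcal M$ a $\mathrm{W}^*$-subalgebra, and $\mathbf x\in\mathcal M_{sa}^I$ a tuple generating $\mathcal M$ as a $\mathrm{W}^*$-algebra, where $I$ is an arbitrary index set. Let $\mathbf R\in(0,\infty)^I$ with $\|x_i\|\le R_i$, let $\mathbf R'\in(0,\infty)^{I'}$, and let $n(k)\to\infty$. (a) Let $\mathbf f\in\mathcal F_{\mathbf R,\mathbf R'}$, let $\mathbf y=\mathbf f(\mathbf x)$ and $\mathcal Q=\mathrm W^*(\mathbf y)$, and suppose that $E_{\mathcal P}\circ E_{\mathcal Q}=E_{\mathcal P\cap\mathcal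 Q}$. If $\{\mu^{(k)}\}$ satisfies (1)–(4) with respect to $\mathcal P\subseteq\mathcal M$, $\mathbf x$ and $\mathbf R$, then $\{\mathbf f_*\mu^{(k)}\}$ is a sequence of Borel probability measures satisfying (1)–(4) with respect to $\mathcal P\cap\mathcal Q\subseteq\mathcal Q$, $\mathbf y$ and $\mathbf R'$. (b) In particular, the existence of such models does not depend on the choice of generators: if $\mathbf y\in\mathcal M_{sa}^{I'}$ also generates $\mathcal M$ and $\|y_i\|\le R_i'$ for all $i$, then there are measures satisfying (1)–(4) with respect to $\mathcal P\subseteq\mathcal M$, $\mathbf x$ and $\mathbf R$ if and only if there are measures (for the same $n(k)$) satisfying (1)–(4) with respect to $\mathcal P\subseteq\mathcal M$, $\mathbf y$ and $\mathbf R'$. -/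

import Mathlib

open scoped TensorProduct Topology InnerProductSpace ComplexOrder ENNReal
open Filter MeasureTheory

universe u

noncomputable section

/-! ### Von Neumann subalgebras: intersections and generation -/

namespace VonNeumannAlgebra

variable {H : Type u} [NormedAddCommGroup H] [InnerProductSpace ℂ H] [CompleteSpace H]

/-- The intersection `P ∩ Q` of two von Neumann algebras on the same Hilbert space. -/
def inter (P Q : VonNeumannAlgebra H) : VonNeumannAlgebra H where
  toStarSubalgebra := P.toStarSubalgebra ⊓ Q.toStarSubalgebra
  centralizer_centralizer' := by
    apply subset_antisymm
    · intro a ha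
      refine ⟨?_, ?_⟩
      · have h : a ∈ Set.centralizer (Set.centralizer (P : Set (H →L[ℂ] H))) :=
          Set.centralizer_subset (Set.centralizer_subset (fun b hb => hb.1)) ha
        rw [P.centralizer_centralizer] at h
        exact h
      · have h : a ∈ Set.centralizer (Set.centralizer (Q : Set (H →L[ℂ] H))) :=
          Set.centralizer_subset (Set.centralizer_subset (fun b hb => hb.2)) ha
        rw [Q.centralizer_centralizer] at h
        exact h
    · exact Set.subset_centralizer_centralizer

/-- The von Neumann algebra `(S ∪ S^*)''` generated by a set `S` of bounded operators. -/
def generatedBy (S : Set (H →L[ℂ] H)) : VonNeumannAlgebra H where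
  toStarSubalgebra :=
    StarSubalgebra.centralizer ℂ (StarSubalgebra.centralizer ℂ S : Set (H →L[ℂ] H))
  centralizer_centralizer' := by
    change Set.centralizer (Set.centralizer (StarSubalgebra.centralizer ℂ
      (StarSubalgebra.centralizer ℂ S : Set (H →L[ℂ] H)) : Set (H →L[ℂ] H))) =
      (StarSubalgebra.centralizer ℂ
      (StarSubalgebra.centralizer ℂ S : Set (H →L[ℂ] H)) : Set (H →L[ℂ] H))
    rw [StarSubalgebra.coe_centralizer_centralizer]
    simp

lemma subset_generatedBy (S : Set (H →L[ℂ] H)) {a : H →L[ℂ] H} (ha : a ∈ S) :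
    a ∈ generatedBy S := by
  change a ∈ (StarSubalgebra.centralizer ℂ
      (StarSubalgebra.centralizer ℂ S : Set (H →L[ℂ] H)) : Set (H →L[ℂ] H))
  rw [StarSubalgebra.coe_centralizer_centralizer]
  exact Set.subset_centralizer_centralizer (Or.inl ha)

lemma generatedBy_le {S : Set (H →L[ℂ] H)} {P : VonNeumannAlgebra H}
    (h : ∀ a ∈ S, a ∈ P) : generatedBy S ≤ P := by
  intro a ha
  change a ∈ (StarSubalgebra.centralizer ℂ
      (StarSubalgebra.centralizer ℂ S : Set (H →L[ℂ] H)) : Set (H →L[ℂ] H)) at ha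
  rw [StarSubalgebra.coe_centralizer_centralizer] at ha
  have hS : S ∪ star S ⊆ (P : Set (H →L[ℂ] H)) := by
    rintro b (hb | hb)
    · exact h b hb
    · have := star_mem (h _ hb)
      rwa [star_star] at this
  have h' := Set.centralizer_subset (Set.centralizer_subset hS) ha
  rw [P.centralizer_centralizer] at h'
  exact h'

end VonNeumannAlgebra

/-! ### Tracial `W^*`-algebras -/

/-- A tracial `W^*`-algebra `(M, τ)`: a von Neumann algebra `alg` on a complex Hilbert space `H`
together with a faithful normal tracial state `τ`.  Normality (ultraweak continuity) of the positive
functional `τ` is expressed in the density-matrix form `τ(a) = ∑ₘ ⟨ξₘ, a ξₘ⟩` with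
`∑ₘ ‖ξₘ‖² < ∞`. -/
structure TracialWStarAlgebra : Type (u + 1) where
  H : Type u
  [instNormedAddCommGroup : NormedAddCommGroup H]
  [instInnerProductSpace : InnerProductSpace ℂ H]
  [instCompleteSpace : CompleteSpace H]
  alg : VonNeumannAlgebra H
  τ : alg.toStarSubalgebra →ₗ[ℂ] ℂ
  unital : τ 1 = 1
  positive : ∀ a, 0 ≤ τ (star a * a)
  tracial : ∀ a b, τ (a * b) = τ (b * a)
  faithful : ∀ a, τ (star a * a) = 0 → a = 0
  normal : ∃ ξ : ℕ → H, Summable (fun m => ‖ξ m‖ ^ 2) ∧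
    ∀ a : alg.toStarSubalgebra, HasSum (fun m => ⟪ξ m, (a : H →L[ℂ] H) (ξ m)⟫_ℂ) (τ a)

attribute [instance] TracialWStarAlgebra.instNormedAddCommGroup
attribute [instance] TracialWStarAlgebra.instInnerProductSpace
attribute [instance] TracialWStarAlgebra.instCompleteSpace

namespace TracialWStarAlgebra

/-- The elements of `M`; the norm is the operator norm. -/
abbrev Elem (M : TracialWStarAlgebra.{u}) : Type u := M.alg.toStarSubalgebra

/-- The `2`-norm `‖a‖₂ = τ(a^* a)^{1/2}`. -/
def norm2 (M : TracialWStarAlgebra.{u}) (a : M.Elem) : ℝ := Real.sqrt (M.τ (star a * a)).re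

/-- A `W^*`-subalgebra `Q ⊆ M`, with the restricted trace, as a tracial `W^*`-algebra. -/
def sub (M : TracialWStarAlgebra.{u}) (Q : VonNeumannAlgebra M.H) (hQ : Q ≤ M.alg) :
    TracialWStarAlgebra.{u} where
  H := M.H
  alg := Q
  τ := M.τ ∘ₗ (StarSubalgebra.inclusion (S₁ := Q.toStarSubalgebra)
    (S₂ := M.alg.toStarSubalgebra) hQ).toAlgHom.toLinearMap
  unital := M.unital
  positive a := M.positive (StarSubalgebra.inclusion (S₁ := Q.toStarSubalgebra)
    (S₂ := M.alg.toStarSubalgebra) hQ a)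
  tracial a b := M.tracial (StarSubalgebra.inclusion (S₁ := Q.toStarSubalgebra)
    (S₂ := M.alg.toStarSubalgebra) hQ a) (StarSubalgebra.inclusion (S₁ := Q.toStarSubalgebra)
    (S₂ := M.alg.toStarSubalgebra) hQ b)
  faithful a h := by
    have := M.faithful (StarSubalgebra.inclusion (S₁ := Q.toStarSubalgebra)
      (S₂ := M.alg.toStarSubalgebra) hQ a) h
    exact Subtype.ext (congrArg Subtype.val this :)
  normal := by
    obtain ⟨ξ, h1, h2⟩ := M.normal
    exact ⟨ξ, h1, fun a => h2 (StarSubalgebra.inclusion (S₁ := Q.toStarSubalgebra)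
      (S₂ := M.alg.toStarSubalgebra) hQ a)⟩

/-- The `W^*`-subalgebra `W^*(x)` generated by a self-adjoint tuple `x` in `M`. -/
def wStar (M : TracialWStarAlgebra.{u}) {I : Type u} (x : I → selfAdjoint M.Elem) :
    VonNeumannAlgebra M.H :=
  VonNeumannAlgebra.generatedBy (Set.range fun i => ((x i : M.Elem) : M.H →L[ℂ] M.H))

lemma wStar_le (M : TracialWStarAlgebra.{u}) {I : Type u} (x : I → selfAdjoint M.Elem) :
    M.wStar x ≤ M.alg :=
  VonNeumannAlgebra.generatedBy_le (by rintro _ ⟨i, rfl⟩; exact (x i : M.Elem).2)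

/-- The tracial `W^*`-algebra `(W^*(x), τ)`. -/
def generated (M : TracialWStarAlgebra.{u}) {I : Type u} (x : I → selfAdjoint M.Elem) :
    TracialWStarAlgebra.{u} :=
  M.sub (M.wStar x) (M.wStar_le x)

/-- The tuple `x`, regarded as a tuple in `W^*(x)`. -/
def generators (M : TracialWStarAlgebra.{u}) {I : Type u} (x : I → selfAdjoint M.Elem) (i : I) :
    selfAdjoint (M.generated x).Elem :=
  ⟨⟨((x i : M.Elem) : M.H →L[ℂ] M.H), VonNeumannAlgebra.subset_generatedBy _ ⟨i, rfl⟩⟩,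
    Subtype.ext (congrArg Subtype.val (x i).2 :)⟩

/-! #### The Hilbert space `L²(M)` and conditional expectations -/

/-- `M` equipped with the inner product `⟨a, b⟩ = τ(a^* b)`. -/
def PreL2 (M : TracialWStarAlgebra.{u}) : Type u := M.Elem

instance (M : TracialWStarAlgebra.{u}) : AddCommGroup M.PreL2 :=
  inferInstanceAs (AddCommGroup M.Elem)

instance (M : TracialWStarAlgebra.{u}) : Module ℂ M.PreL2 :=
  inferInstanceAs (Module ℂ M.Elem)

def toPreL2 (M : TracialWStarAlgebra.{u}) : M.Elem ≃ₗ[ℂ] M.PreL2 := LinearEquiv.refl ℂ _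

lemma τ_star (M : TracialWStarAlgebra.{u}) (a : M.Elem) :
    M.τ (star a) = starRingEnd ℂ (M.τ a) := by
  obtain ⟨ξ, -, h⟩ := M.normal
  have h1 := (Complex.hasSum_conj'.mpr (h a))
  refine (h (star a)).unique ?_
  convert h1 using 2 with m
  simp only [StarMemClass.coe_star, ContinuousLinearMap.star_eq_adjoint]
  rw [ContinuousLinearMap.adjoint_inner_right, inner_conj_symm]

abbrev core (M : TracialWStarAlgebra.{u}) : InnerProductSpace.Core ℂ M.PreL2 where
  inner a b := M.τ (star (M.toPreL2.symm a) * M.toPreL2.symm b)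
  conj_inner_symm a b := by
    rw [← M.τ_star]; simp
  re_inner_nonneg a := (RCLike.nonneg_iff.mp (M.positive (M.toPreL2.symm a))).1
  add_left a b c := by simp [add_mul]
  smul_left a b r := by simp
  definite a h := by
    have := M.faithful _ h
    simpa using this

instance (M : TracialWStarAlgebra.{u}) : NormedAddCommGroup M.PreL2 :=
  InnerProductSpace.Core.toNormedAddCommGroup (cd := M.core)

instance (M : TracialWStarAlgebra.{u}) : InnerProductSpace ℂ M.PreL2 :=
  InnerProductSpace.ofCore M.core.toCore

/-- The Hilbert space `L²(M)`: the completion of `M` for the `2`-norm. -/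
abbrev L2 (M : TracialWStarAlgebra.{u}) : Type u := UniformSpace.Completion M.PreL2

/-- The canonical map `M → L²(M)`. -/
def toL2 (M : TracialWStarAlgebra.{u}) : M.Elem →ₗ[ℂ] M.L2 :=
  (UniformSpace.Completion.toComplₗᵢ (𝕜 := ℂ) (E := M.PreL2)).toLinearMap ∘ₗ M.toPreL2.toLinearMap

lemma inner_toL2 (M : TracialWStarAlgebra.{u}) (a b : M.Elem) :
    ⟪M.toL2 a, M.toL2 b⟫_ℂ = M.τ (star a * b) := by
  change ⟪((M.toPreL2 a : M.PreL2) : M.L2), ((M.toPreL2 b : M.PreL2) : M.L2)⟫_ℂ = _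
  rw [UniformSpace.Completion.inner_coe]
  rfl

lemma norm_toL2 (M : TracialWStarAlgebra.{u}) (a : M.Elem) : ‖M.toL2 a‖ = M.norm2 a := by
  rw [norm_eq_sqrt_re_inner (𝕜 := ℂ), inner_toL2]; rfl

lemma toL2_injective (M : TracialWStarAlgebra.{u}) : Function.Injective M.toL2 := by
  intro a b h
  exact M.toPreL2.injective (UniformSpace.Completion.coe_injective _ h)

/-- The subspace `L²(P) ⊆ L²(M)`: the closure of `P`. -/
def L2Sub (M : TracialWStarAlgebra.{u}) (P : VonNeumannAlgebra M.H) : Submodule ℂ M.L2 :=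
  (Submodule.map M.toL2 (Submodule.comap M.alg.toStarSubalgebra.toSubalgebra.toSubmodule.subtype
    P.toStarSubalgebra.toSubalgebra.toSubmodule)).topologicalClosure

/-- The trace-preserving conditional expectation `E_P` of `M` onto a `W^*`-subalgebra `P`, extended
to `L²(M)`, i.e. the orthogonal projection of `L²(M)` onto `L²(P)`.  On `M` it agrees with the
trace-preserving conditional expectation `M → P`, see `condExp_toL2_eq`. -/
def condExp (M : TracialWStarAlgebra.{u}) (P : VonNeumannAlgebra M.H) : M.L2 →L[ℂ] M.L2 :=
  haveI : CompleteSpace (M.L2Sub P) :=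
    (Submodule.isClosed_topologicalClosure _).completeSpace_coe
  (M.L2Sub P).starProjection

/-- The characteristic property of `E_P(a)`: if `b ∈ P` and `τ(c b) = τ(c a)` for all `c ∈ P`, then
`b = E_P(a)`. -/
lemma condExp_toL2_eq (M : TracialWStarAlgebra.{u}) (P : VonNeumannAlgebra M.H) (a b : M.Elem)
    (hb : (b : M.H →L[ℂ] M.H) ∈ P)
    (h : ∀ c : M.Elem, (c : M.H →L[ℂ] M.H) ∈ P → M.τ (c * b) = M.τ (c * a)) :
    M.condExp P (M.toL2 a) = M.toL2 b := by
  have : CompleteSpace (M.L2Sub P) :=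
    (Submodule.isClosed_topologicalClosure _).completeSpace_coe
  have hmem : M.toL2 b ∈ M.L2Sub P := Submodule.le_topologicalClosure _ ⟨b, hb, rfl⟩
  refine Submodule.eq_starProjection_of_mem_of_inner_eq_zero (K := M.L2Sub P) hmem ?_
  intro w hw
  have hcl : IsClosed {w : M.L2 | ⟪M.toL2 a - M.toL2 b, w⟫_ℂ = 0} :=
    isClosed_eq (by fun_prop) continuous_const
  refine closure_minimal ?_ hcl hw
  rintro _ ⟨c, hc, rfl⟩
  have hc' : ((star c : M.Elem) : M.H →L[ℂ] M.H) ∈ P := star_mem (S := VonNeumannAlgebra M.H) hc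
  have := h (star c) hc'
  rw [Set.mem_ofPred_eq, ← inner_conj_symm, inner_sub_right, inner_toL2, inner_toL2, this]
  simp

end TracialWStarAlgebra

/-! ### Matrix algebras -/

/-- The orthonormal basis vectors of `ℂⁿ`. -/
abbrev matrixBasis (n : ℕ) : OrthonormalBasis (ULift.{u} (Fin n)) ℂ
    (EuclideanSpace ℂ (ULift.{u} (Fin n))) :=
  EuclideanSpace.basisFun _ ℂ

/-- All operators on `H`, as a von Neumann algebra. -/
def allOperators (H : Type u) [NormedAddCommGroup H] [InnerProductSpace ℂ H] [CompleteSpace H] :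
    VonNeumannAlgebra H where
  toStarSubalgebra := ⊤
  centralizer_centralizer' := by
    apply subset_antisymm
    · intro a _; trivial
    · exact Set.subset_centralizer_centralizer

/-- The space `ℂⁿ`. -/
abbrev CSpace (n : ℕ) : Type u := EuclideanSpace ℂ (ULift.{u} (Fin n))

/-- The trace `Tr` of operators on `ℂⁿ`. -/
def opTrace (n : ℕ) : (CSpace.{u} n →L[ℂ] CSpace.{u} n) →ₗ[ℂ] ℂ :=
  LinearMap.trace ℂ (CSpace.{u} n) ∘ₗ ContinuousLinearMap.coeLM ℂ

lemma opTrace_eq_sum (n : ℕ) (a : CSpace.{u} n →L[ℂ] CSpace.{u} n) :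
    opTrace n a = ∑ i, ⟪matrixBasis.{u} n i, a (matrixBasis.{u} n i)⟫_ℂ :=
  LinearMap.trace_eq_sum_inner _ (matrixBasis.{u} n)

lemma opTrace_star_mul_self (n : ℕ) (a : CSpace.{u} n →L[ℂ] CSpace.{u} n) :
    opTrace n (star a * a) = ((∑ i, ‖a (matrixBasis.{u} n i)‖ ^ 2 : ℝ) : ℂ) := by
  rw [opTrace_eq_sum]
  push_cast
  refine Finset.sum_congr rfl fun i _ => ?_
  change ⟪matrixBasis.{u} n i, star a (a (matrixBasis.{u} n i))⟫_ℂ = _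
  rw [ContinuousLinearMap.star_eq_adjoint,
    ContinuousLinearMap.adjoint_inner_right, inner_self_eq_norm_sq_to_K]
  rfl

/-- The tracial `W^*`-algebra `(M_n(ℂ), τ_n)`: all operators on `ℂⁿ` with the normalized trace
`τ_n = (1/n) Tr`. -/
def matrixAlgebra (n : ℕ) [NeZero n] : TracialWStarAlgebra.{u} where
  H := CSpace.{u} n
  alg := allOperators _
  τ := (n : ℂ)⁻¹ • (opTrace.{u} n ∘ₗ
    (allOperators (CSpace.{u} n)).toStarSubalgebra.subtype.toAlgHom.toLinearMap)
  unital := by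
    change (n : ℂ)⁻¹ • LinearMap.trace ℂ (CSpace.{u} n) 1 = 1
    rw [LinearMap.trace_one]
    simp
  positive a := by
    change 0 ≤ (n : ℂ)⁻¹ • opTrace n (star a.1 * a.1)
    rw [opTrace_star_mul_self, smul_eq_mul]
    refine mul_nonneg (by positivity) ?_
    exact_mod_cast Finset.sum_nonneg fun i _ => by positivity
  tracial a b := by
    change (n : ℂ)⁻¹ • LinearMap.trace ℂ (CSpace.{u} n) ((a.1 : CSpace.{u} n →ₗ[ℂ] CSpace.{u} n) * (b.1 : CSpace.{u} n →ₗ[ℂ] CSpace.{u} n)) =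
      (n : ℂ)⁻¹ • LinearMap.trace ℂ (CSpace.{u} n) ((b.1 : CSpace.{u} n →ₗ[ℂ] CSpace.{u} n) * (a.1 : CSpace.{u} n →ₗ[ℂ] CSpace.{u} n))
    rw [LinearMap.trace_mul_comm]
  faithful a h := by
    change (n : ℂ)⁻¹ • opTrace n (star a.1 * a.1) = 0 at h
    rw [opTrace_star_mul_self, smul_eq_mul, mul_eq_zero] at h
    have h' := h.resolve_left (by simp [NeZero.ne n])
    rw [Complex.ofReal_eq_zero, Finset.sum_eq_zero_iff_of_nonneg (fun i _ => by positivity)] at h'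
    apply Subtype.ext
    apply ContinuousLinearMap.coe_injective
    refine (matrixBasis.{u} n).toBasis.ext fun i => ?_
    simpa using h' i (Finset.mem_univ i)
  normal := by
    let c : ℂ := ((Real.sqrt n)⁻¹ : ℝ)
    have hc : starRingEnd ℂ c * c = (n : ℂ)⁻¹ := by
      simp only [c, Complex.conj_ofReal]
      rw [← Complex.ofReal_mul, ← mul_inv, Real.mul_self_sqrt (by positivity)]
      simp
    let ξ : ℕ → CSpace.{u} n := fun m =>
      if h : m < n then c • matrixBasis.{u} n ⟨⟨m, h⟩⟩ else 0
    have hξ : ∀ m ∉ Finset.range n, ξ m = 0 := by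
      intro m hm
      simp only [Finset.mem_range] at hm
      simp [ξ, hm]
    refine ⟨ξ, summable_of_ne_finset_zero (s := Finset.range n) ?_, fun a => ?_⟩
    · intro m hm
      simp [hξ m hm]
    · have key : (∑ m ∈ Finset.range n, ⟪ξ m, a.1 (ξ m)⟫_ℂ) =
          (n : ℂ)⁻¹ • opTrace n a.1 := by
        rw [opTrace_eq_sum, Finset.sum_range, smul_eq_mul, Finset.mul_sum,
          ← Equiv.sum_comp Equiv.ulift.symm]
        refine Finset.sum_congr rfl fun i _ => ?_
        simp only [ξ, i.2, dif_pos, map_smul, inner_smul_left, inner_smul_right]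
        rw [← mul_assoc, mul_comm c, hc]
        rfl
      change HasSum _ ((n : ℂ)⁻¹ • opTrace n a.1)
      rw [← key]
      refine hasSum_sum_of_ne_finset_zero ?_
      intro m hm
      simp [hξ m hm]

/-! ### Non-commutative polynomials and laws -/

/-- The algebra `ℂ⟨tᵢ : i ∈ I⟩` of non-commutative polynomials. -/
abbrev NCPoly (I : Type u) : Type u := FreeAlgebra ℂ I

namespace NCPoly

variable {I : Type u}

/-- `ℂ⟨tᵢ⟩` with the conjugate scalar multiplication `(c, p) ↦ \bar c p`. -/
def Conj (I : Type u) : Type u := NCPoly I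

instance : Semiring (Conj I) := inferInstanceAs (Semiring (NCPoly I))

instance : Algebra ℂ (Conj I) :=
  ((algebraMap ℂ (NCPoly I)).comp (starRingEnd ℂ)).toAlgebra'
    (fun c x => Algebra.commutes (R := ℂ) (A := NCPoly I) (starRingEnd ℂ c) x)

/-- The ring homomorphism of `ℂ⟨tᵢ⟩` that conjugates all coefficients and fixes every `tᵢ`. -/
def conjCoeff : NCPoly I →+* NCPoly I :=
  (FreeAlgebra.lift ℂ (A := Conj I) (FreeAlgebra.ι ℂ : I → NCPoly I)).toRingHom

/-- The involution `p ↦ p^*` of `ℂ⟨tᵢ⟩`: conjugate-linear, anti-multiplicative, `tᵢ^* = tᵢ`.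
(The involution `star` of `FreeAlgebra` is `ℂ`-linear.) -/
def adj (p : NCPoly I) : NCPoly I := star (conjCoeff p)

@[simp] lemma adj_algebraMap (c : ℂ) :
    adj (algebraMap ℂ (NCPoly I) c) = algebraMap ℂ (NCPoly I) (starRingEnd ℂ c) := by
  have : conjCoeff (algebraMap ℂ (NCPoly I) c) = algebraMap ℂ (NCPoly I) (starRingEnd ℂ c) :=
    (FreeAlgebra.lift ℂ (A := Conj I) (FreeAlgebra.ι ℂ : I → NCPoly I)).commutes c
  rw [adj, this, FreeAlgebra.star_algebraMap]

@[simp] lemma adj_ι (i : I) : adj (FreeAlgebra.ι ℂ i) = FreeAlgebra.ι ℂ i := by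
  have : conjCoeff (FreeAlgebra.ι ℂ i) = FreeAlgebra.ι ℂ i :=
    FreeAlgebra.lift_ι_apply (A := Conj I) (FreeAlgebra.ι ℂ : I → NCPoly I) i
  rw [adj, this, FreeAlgebra.star_ι]

@[simp] lemma adj_add (p q : NCPoly I) : adj (p + q) = adj p + adj q := by simp [adj]

@[simp] lemma adj_mul (p q : NCPoly I) : adj (p * q) = adj q * adj p := by simp [adj]

end NCPoly

namespace TracialWStarAlgebra

variable {I : Type u}

/-- Evaluation `p(x)` of a non-commutative polynomial at a self-adjoint tuple. -/
def evalPoly (M : TracialWStarAlgebra.{u}) (x : I → selfAdjoint M.Elem) : NCPoly I →ₐ[ℂ] M.Elem :=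
  FreeAlgebra.lift ℂ fun i => (x i : M.Elem)

lemma evalPoly_adj (M : TracialWStarAlgebra.{u}) (x : I → selfAdjoint M.Elem) (p : NCPoly I) :
    M.evalPoly x p.adj = star (M.evalPoly x p) := by
  induction p using FreeAlgebra.induction with
  | grade0 c =>
    rw [NCPoly.adj_algebraMap, AlgHom.commutes, AlgHom.commutes, ← algebraMap_star_comm]; rfl
  | grade1 i =>
    rw [NCPoly.adj_ι]
    simp only [evalPoly, FreeAlgebra.lift_ι_apply]
    exact (x i).2.symm
  | mul p q hp hq => simp [hp, hq]
  | add p q hp hq => simp [hp, hq]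

lemma norm_τ_le (M : TracialWStarAlgebra.{u}) (a : M.Elem) : ‖M.τ a‖ ≤ ‖a‖ := by
  obtain ⟨ξ, hs, h⟩ := M.normal
  have h1 : HasSum (fun m => ‖ξ m‖ ^ 2) 1 := by
    have h2 := h 1
    rw [M.unital] at h2
    have h3 : HasSum (fun m => ((‖ξ m‖ ^ 2 : ℝ) : ℂ)) ((1 : ℝ) : ℂ) := by
      convert h2 using 2 with m
      · simp only [OneMemClass.coe_one, one_apply_eq_self]
        rw [inner_self_eq_norm_sq_to_K]
        push_cast
        rfl
      · simp
    exact Complex.hasSum_ofReal.mp h3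
  have h4 : HasSum (fun m => ‖a‖ * ‖ξ m‖ ^ 2) (‖a‖ * 1) := h1.mul_left _
  rw [mul_one] at h4
  refine (h a).norm_le_of_bounded h4 fun m => ?_
  calc ‖⟪ξ m, (a : M.H →L[ℂ] M.H) (ξ m)⟫_ℂ‖ ≤ ‖ξ m‖ * ‖(a : M.H →L[ℂ] M.H) (ξ m)‖ :=
        norm_inner_le_norm _ _
    _ ≤ ‖ξ m‖ * (‖a‖ * ‖ξ m‖) := by
        gcongr
        exact (a : M.H →L[ℂ] M.H).le_opNorm _
    _ = ‖a‖ * ‖ξ m‖ ^ 2 := by ring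

lemma norm2_le (M : TracialWStarAlgebra.{u}) (a : M.Elem) : M.norm2 a ≤ ‖a‖ := by
  refine Real.sqrt_le_iff.mpr ⟨norm_nonneg _, ?_⟩
  calc (M.τ (star a * a)).re ≤ ‖M.τ (star a * a)‖ := Complex.re_le_norm _
    _ ≤ ‖star a * a‖ := M.norm_τ_le _
    _ = ‖a‖ ^ 2 := by rw [CStarRing.norm_star_mul_self, sq]

end TracialWStarAlgebra

/-- `λ` is a non-commutative law of a self-adjoint `I`-tuple with bound `R`: a unital, positive,
tracial linear functional with `|λ(t_{i(1)} ⋯ t_{i(ℓ)})| ≤ R_{i(1)} ⋯ R_{i(ℓ)}`. -/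
structure IsNCLaw {I : Type u} (R : I → ℝ) (l : NCPoly I →ₗ[ℂ] ℂ) : Prop where
  unital : l 1 = 1
  positive : ∀ p : NCPoly I, 0 ≤ l (p.adj * p)
  tracial : ∀ p q : NCPoly I, l (p * q) = l (q * p)
  bounded : ∀ w : List I, ‖l (w.map (FreeAlgebra.ι ℂ)).prod‖ ≤ (w.map R).prod

/-- The space `Σ_R` of non-commutative laws with bound `R`. -/
def NCLaw {I : Type u} (R : I → ℝ) : Type u := {l : NCPoly I →ₗ[ℂ] ℂ // IsNCLaw R l}

/-- The topology of pointwise convergence on `Σ_R`. -/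
instance {I : Type u} (R : I → ℝ) : TopologicalSpace (NCLaw R) :=
  TopologicalSpace.induced (fun l => (l.1 : NCPoly I → ℂ)) inferInstance

namespace NCLaw

variable {I : Type u}

lemma exists_bound (R : I → ℝ) (p : NCPoly I) : ∃ C : ℝ, ∀ l : NCLaw R, ‖l.1 p‖ ≤ C := by
  set S : Set (NCPoly I) := Set.range fun w : List I => (w.map (FreeAlgebra.ι ℂ)).prod with hS
  have hSS : ∀ a ∈ S, ∀ b ∈ S, a * b ∈ S := by
    rintro _ ⟨v, rfl⟩ _ ⟨w, rfl⟩
    exact ⟨v ++ w, by simp⟩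
  have h1 : (1 : NCPoly I) ∈ Submodule.span ℂ S := Submodule.subset_span ⟨[], by simp⟩
  have hp : p ∈ Submodule.span ℂ S := by
    induction p using FreeAlgebra.induction with
    | grade0 c =>
      rw [Algebra.algebraMap_eq_smul_one]
      exact Submodule.smul_mem _ _ h1
    | grade1 i => exact Submodule.subset_span ⟨[i], by simp⟩
    | mul p q hp hq =>
      have h2 : ∀ a ∈ S, a * q ∈ Submodule.span ℂ S := fun a ha => by
        induction hq using Submodule.span_induction with
        | mem b hb => exact Submodule.subset_span (hSS a ha b hb)
        | zero => simp
        | add b c _ _ hb hc => rw [mul_add]; exact Submodule.add_mem _ hb hc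
        | smul c b _ hb => rw [mul_smul_comm]; exact Submodule.smul_mem _ _ hb
      induction hp using Submodule.span_induction with
      | mem a ha => exact h2 a ha
      | zero => simp
      | add b c _ _ hb hc => rw [add_mul]; exact Submodule.add_mem _ hb hc
      | smul c b _ hb => rw [smul_mul_assoc]; exact Submodule.smul_mem _ _ hb
    | add p q hp hq => exact Submodule.add_mem _ hp hq
  induction hp using Submodule.span_induction with
  | mem q hq =>
    obtain ⟨w, rfl⟩ := hq
    exact ⟨_, fun l => l.2.bounded w⟩
  | zero => exact ⟨0, fun l => by simp⟩
  | add q r _ _ hq hr =>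
    obtain ⟨C, hC⟩ := hq
    obtain ⟨D, hD⟩ := hr
    exact ⟨C + D, fun l => by
      rw [map_add]
      exact (norm_add_le _ _).trans (add_le_add (hC l) (hD l))⟩
  | smul c q _ hq =>
    obtain ⟨C, hC⟩ := hq
    exact ⟨‖c‖ * C, fun l => by
      rw [map_smul, norm_smul]
      exact mul_le_mul_of_nonneg_left (hC l) (norm_nonneg _)⟩

lemma range_coe (R : I → ℝ) :
    Set.range (fun l : NCLaw R => (l.1 : NCPoly I → ℂ)) =
      {g | ((∀ p q, g (p + q) = g p + g q) ∧ (∀ (c : ℂ) p, g (c • p) = c • g p)) ∧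
        (g 1 = 1 ∧ (∀ p : NCPoly I, 0 ≤ g (p.adj * p)) ∧ (∀ p q, g (p * q) = g (q * p)) ∧
        ∀ w : List I, ‖g (w.map (FreeAlgebra.ι ℂ)).prod‖ ≤ (w.map R).prod)} := by
  ext g
  constructor
  · rintro ⟨l, rfl⟩
    exact ⟨⟨map_add l.1, map_smul l.1⟩, l.2.unital, l.2.positive, l.2.tracial, l.2.bounded⟩
  · rintro ⟨⟨h1, h2⟩, h3, h4, h5, h6⟩
    exact ⟨⟨⟨⟨g, h1⟩, h2⟩, ⟨h3, h4, h5, h6⟩⟩, rfl⟩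

instance (R : I → ℝ) : CompactSpace (NCLaw R) := by
  have hind : Topology.IsInducing (fun l : NCLaw R => (l.1 : NCPoly I → ℂ)) := ⟨rfl⟩
  refine ⟨hind.isCompact_iff.mpr ?_⟩
  rw [Set.image_univ]
  choose C hC using exists_bound R
  refine IsCompact.of_isClosed_subset
    (isCompact_univ_pi fun p => isCompact_closedBall (0 : ℂ) (C p)) ?_ ?_
  · rw [range_coe]
    have hall {ι : Type u} {q : ι → (NCPoly I → ℂ) → Prop} (h : ∀ i, IsClosed {g | q i g}) :
        IsClosed {g | ∀ i, q i g} := by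
      have : {g | ∀ i, q i g} = ⋂ i, {g | q i g} := by ext; simp
      rw [this]
      exact isClosed_iInter h
    have hallc {q : ℂ → (NCPoly I → ℂ) → Prop} (h : ∀ i, IsClosed {g | q i g}) :
        IsClosed {g | ∀ i, q i g} := by
      have : {g | ∀ i, q i g} = ⋂ i, {g | q i g} := by ext; simp
      rw [this]
      exact isClosed_iInter h
    refine IsClosed.and (IsClosed.and ?_ ?_) (IsClosed.and ?_ (IsClosed.and ?_ (IsClosed.and ?_ ?_)))
    · exact hall fun p => hall fun q => isClosed_eq (by fun_prop) (by fun_prop)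
    · exact hallc fun c => hall fun q => isClosed_eq (by fun_prop) (by fun_prop)
    · exact isClosed_eq (by fun_prop) (by fun_prop)
    · exact hall fun p => isClosed_le (by fun_prop) (by fun_prop)
    · exact hall fun p => hall fun q => isClosed_eq (by fun_prop) (by fun_prop)
    · exact hall fun w => isClosed_le (by fun_prop) (by fun_prop)
  · rintro _ ⟨l, rfl⟩ p _
    simpa using hC p l

end NCLaw

namespace TracialWStarAlgebra

variable {I : Type u}

/-- The law `λ_x : p ↦ τ(p(x))` of a self-adjoint tuple with `‖xᵢ‖ ≤ Rᵢ`, as a point of `Σ_R`. -/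
def law (M : TracialWStarAlgebra.{u}) {R : I → ℝ} (x : I → selfAdjoint M.Elem)
    (hx : ∀ i, ‖(x i : M.Elem)‖ ≤ R i) : NCLaw R :=
  ⟨M.τ ∘ₗ (M.evalPoly x).toLinearMap, by
    refine ⟨?_, ?_, ?_, ?_⟩
    · simpa using M.unital
    · intro p
      simpa [M.evalPoly_adj] using M.positive (M.evalPoly x p)
    · intro p q
      simpa using M.tracial (M.evalPoly x p) (M.evalPoly x q)
    · intro w
      refine (M.norm_τ_le _).trans ?_
      change ‖M.evalPoly x (w.map (FreeAlgebra.ι ℂ)).prod‖ ≤ _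
      induction w with
      | nil =>
        simp only [List.map_nil, List.prod_nil, map_one]
        exact ContinuousLinearMap.norm_id_le
      | cons i w ih =>
        simp only [List.map_cons, List.prod_cons, map_mul]
        refine (norm_mul_le _ _).trans ?_
        refine mul_le_mul ?_ ih (norm_nonneg _) ((norm_nonneg _).trans (hx i))
        simpa [evalPoly] using hx i⟩

/-- The evaluation map `ev_x : C(Σ_R) ⊗ ℂ⟨tᵢ⟩ → M`, `φ ⊗ p ↦ φ(λ_x) p(x)`. -/
def ev (M : TracialWStarAlgebra.{u}) {R : I → ℝ} (x : I → selfAdjoint M.Elem)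
    (hx : ∀ i, ‖(x i : M.Elem)‖ ≤ R i) : C(NCLaw R, ℂ) ⊗[ℂ] NCPoly I →ₗ[ℂ] M.Elem :=
  TensorProduct.lift (LinearMap.mk₂ ℂ (fun φ p => φ (M.law x hx) • M.evalPoly x p)
    (fun φ ψ p => by simp [add_smul]) (fun c φ p => by simp [mul_smul])
    (fun φ p q => by simp) (fun c φ p => by rw [map_smul, smul_comm]))

@[simp] lemma ev_tmul (M : TracialWStarAlgebra.{u}) {R : I → ℝ} (x : I → selfAdjoint M.Elem)
    (hx : ∀ i, ‖(x i : M.Elem)‖ ≤ R i) (φ : C(NCLaw R, ℂ)) (p : NCPoly I) :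
    M.ev x hx (φ ⊗ₜ p) = φ (M.law x hx) • M.evalPoly x p := rfl

end TracialWStarAlgebra

/-! ### The function spaces `F_{R,2}`, `F_{R,∞}` and `F_{R,R'}` -/

/-- The space `A_R = C(Σ_R) ⊗ ℂ⟨tᵢ⟩` with the seminorm `‖·‖_{R,2}`. -/
def FunA {I : Type u} (R : I → ℝ) : Type u := C(NCLaw R, ℂ) ⊗[ℂ] NCPoly I

namespace FunA

variable {I : Type u} {R : I → ℝ}

instance : AddCommGroup (FunA R) := inferInstanceAs (AddCommGroup (C(NCLaw R, ℂ) ⊗[ℂ] NCPoly I))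

/-- The evaluation `f(x)` of `f ∈ A_R`. -/
def eval (M : TracialWStarAlgebra.{u}) (x : I → selfAdjoint M.Elem)
    (hx : ∀ i, ‖(x i : M.Elem)‖ ≤ R i) : FunA R →+ M.Elem :=
  (M.ev x hx).toAddMonoidHom

/-- The values `‖f(x)‖₂`, over all tracial `W^*`-algebras `M` and all self-adjoint tuples `x` in `M`
with `‖xᵢ‖ ≤ Rᵢ`. -/
def values (f : FunA R) : Set ℝ :=
  {r | ∃ (M : TracialWStarAlgebra.{u}) (x : I → selfAdjoint M.Elem)
    (hx : ∀ i, ‖(x i : M.Elem)‖ ≤ R i), r = ‖M.toL2 (eval M x hx f)‖}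

lemma bddAbove_values (f : FunA R) : BddAbove (values f) := by
  suffices h : ∃ C : ℝ, ∀ (M : TracialWStarAlgebra.{u}) (x : I → selfAdjoint M.Elem)
      (hx : ∀ i, ‖(x i : M.Elem)‖ ≤ R i), ‖M.toL2 (M.ev x hx f)‖ ≤ C by
    obtain ⟨C, hC⟩ := h
    exact ⟨C, by rintro _ ⟨M, x, hx, rfl⟩; exact hC M x hx⟩
  induction f using TensorProduct.induction_on with
  | zero => exact ⟨0, fun M x hx => by simp⟩
  | add f g hf hg =>
    obtain ⟨C, hC⟩ := hf
    obtain ⟨D, hD⟩ := hg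
    exact ⟨C + D, fun M x hx => by
      rw [map_add, map_add]
      exact (norm_add_le _ _).trans (add_le_add (hC M x hx) (hD M x hx))⟩
  | tmul φ p =>
    obtain ⟨C, hC⟩ := NCLaw.exists_bound R (p.adj * p)
    refine ⟨‖φ‖ * Real.sqrt C, fun M x hx => ?_⟩
    rw [TracialWStarAlgebra.ev_tmul, map_smul, norm_smul, M.norm_toL2]
    refine mul_le_mul (φ.norm_coe_le_norm _) (Real.sqrt_le_sqrt ?_) (Real.sqrt_nonneg _)
      (norm_nonneg _)
    have := hC (M.law x hx)
    rw [← M.evalPoly_adj, ← map_mul]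
    exact (Complex.re_le_norm _).trans this

/-- The seminorm `‖f‖_{R,2} = sup ‖f(x)‖₂` over all tracial `W^*`-algebras and all self-adjoint
tuples `x` with `‖xᵢ‖ ≤ Rᵢ`. -/
def seminorm : AddGroupSeminorm (FunA R) where
  toFun f := sSup (values f)
  map_zero' := by
    refine le_antisymm (Real.sSup_le ?_ le_rfl) (Real.sSup_nonneg ?_)
    · rintro _ ⟨M, x, hx, rfl⟩; simp
    · rintro _ ⟨M, x, hx, rfl⟩; exact norm_nonneg _
  add_le' f g := by
    have h0 (f : FunA R) : 0 ≤ sSup (values f) :=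
      Real.sSup_nonneg (by rintro _ ⟨M, x, hx, rfl⟩; exact norm_nonneg _)
    refine Real.sSup_le ?_ (add_nonneg (h0 f) (h0 g))
    rintro _ ⟨M, x, hx, rfl⟩
    rw [map_add, map_add]
    exact (norm_add_le _ _).trans (add_le_add (le_csSup (bddAbove_values f) ⟨M, x, hx, rfl⟩)
      (le_csSup (bddAbove_values g) ⟨M, x, hx, rfl⟩))
  neg' f := by
    congr 1
    ext r
    simp [values]

instance : SeminormedAddCommGroup (FunA R) := seminorm.toSeminormedAddCommGroup

lemma norm_eval_le (M : TracialWStarAlgebra.{u}) (x : I → selfAdjoint M.Elem)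
    (hx : ∀ i, ‖(x i : M.Elem)‖ ≤ R i) (f : FunA R) : ‖M.toL2 (eval M x hx f)‖ ≤ ‖f‖ :=
  le_csSup (bddAbove_values f) ⟨M, x, hx, rfl⟩

end FunA

/-- The space `F_{R,2}`: the (Hausdorff) completion of `A_R` for `‖·‖_{R,2}`. -/
abbrev Fun2 {I : Type u} (R : I → ℝ) : Type u := UniformSpace.Completion (FunA R)

namespace Fun2

variable {I : Type u} {R : I → ℝ}

/-- The evaluation `f(x) ∈ L²(M)` of `f ∈ F_{R,2}`: the continuous extension of the evaluation of
`A_R`. -/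
def eval (M : TracialWStarAlgebra.{u}) (x : I → selfAdjoint M.Elem)
    (hx : ∀ i, ‖(x i : M.Elem)‖ ≤ R i) : Fun2 R → M.L2 :=
  UniformSpace.Completion.extension fun f : FunA R => M.toL2 (FunA.eval M x hx f)

lemma eval_coe (M : TracialWStarAlgebra.{u}) (x : I → selfAdjoint M.Elem)
    (hx : ∀ i, ‖(x i : M.Elem)‖ ≤ R i) (f : FunA R) :
    eval M x hx (f : Fun2 R) = M.toL2 (FunA.eval M x hx f) := by
  refine UniformSpace.Completion.extension_coe ?_ f
  refine AddMonoidHomClass.uniformContinuous_of_bound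
    (M.toL2.toAddMonoidHom.comp (FunA.eval M x hx)) 1 fun f => ?_
  rw [one_mul]
  exact FunA.norm_eval_le M x hx f

/-- `f` is a self-adjoint element of `F_{R,∞}` with `‖f‖_{R,∞} ≤ C`: for every tracial `W^*`-algebra
`M` and every self-adjoint tuple `x` in `M` with `‖xᵢ‖ ≤ Rᵢ`, the vector `f(x) ∈ L²(M)` is a
self-adjoint element of `M` of operator norm at most `C`. -/
def IsSelfAdjointBoundedBy (f : Fun2 R) (C : ℝ) : Prop :=
  ∀ (M : TracialWStarAlgebra.{u}) (x : I → selfAdjoint M.Elem)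
    (hx : ∀ i, ‖(x i : M.Elem)‖ ≤ R i),
    ∃ a : selfAdjoint M.Elem, M.toL2 a = eval M x hx f ∧ ‖(a : M.Elem)‖ ≤ C

end Fun2

/-- The space `F_{R,R'}` of `I'`-tuples of self-adjoint elements `fᵢ` of `F_{R,∞}` with
`‖fᵢ‖_{R,∞} ≤ R'ᵢ`. -/
def FunTuple {I I' : Type u} (R : I → ℝ) (R' : I' → ℝ) : Type u :=
  {f : I' → Fun2 R // ∀ i, (f i).IsSelfAdjointBoundedBy (R' i)}

/-- The evaluation `f(x) = (fᵢ(x))ᵢ`, a self-adjoint tuple in `M`. -/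
def FunTuple.eval {I I' : Type u} {R : I → ℝ} {R' : I' → ℝ} (f : FunTuple R R')
    (M : TracialWStarAlgebra.{u}) (x : I → selfAdjoint M.Elem)
    (hx : ∀ i, ‖(x i : M.Elem)‖ ≤ R i) (i : I') : selfAdjoint M.Elem :=
  (f.2 i M x hx).choose

lemma FunTuple.toL2_eval {I I' : Type u} {R : I → ℝ} {R' : I' → ℝ} (f : FunTuple R R')
    (M : TracialWStarAlgebra.{u}) (x : I → selfAdjoint M.Elem)
    (hx : ∀ i, ‖(x i : M.Elem)‖ ≤ R i) (i : I') :
    M.toL2 (f.eval M x hx i) = Fun2.eval M x hx (f.1 i) :=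
  (f.2 i M x hx).choose_spec.1

/-! ### Random matrix models -/

/-- The space `M_n(ℂ)_sa^I` with the product topology. -/
def MatTuple (I : Type u) (n : ℕ) [NeZero n] : Type u := I → selfAdjoint (matrixAlgebra.{u} n).Elem

instance (I : Type u) (n : ℕ) [NeZero n] : TopologicalSpace (MatTuple I n) :=
  inferInstanceAs (TopologicalSpace (I → selfAdjoint (matrixAlgebra.{u} n).Elem))

/-- The Borel `σ`-algebra of the product topology. -/
instance (I : Type u) (n : ℕ) [NeZero n] : MeasurableSpace (MatTuple I n) := borel _

instance (I : Type u) (n : ℕ) [NeZero n] : BorelSpace (MatTuple I n) := ⟨rfl⟩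

namespace MatTuple

variable {I I' : Type u} {n : ℕ} [NeZero n]

/-- The set `{A : ‖Aᵢ‖ ≤ Rᵢ for all i}`. -/
def box (R : I → ℝ) : Set (MatTuple I n) :=
  {A | ∀ i, ‖(A i : (matrixAlgebra.{u} n).Elem)‖ ≤ R i}

/-- The `(F, ε)`-neighbourhood `N_{F,ε}(Ω)`. -/
def nhd (F : Finset I) (ε : ℝ) (Ω : Set (MatTuple I n)) : Set (MatTuple I n) :=
  {B | ∃ A ∈ Ω, ∀ i ∈ F, (matrixAlgebra.{u} n).norm2 (A i - B i) < ε}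

/-- The concentration function `α_μ(F, ε) = sup {μ(N_{F,ε}(Ω)ᶜ) : Ω Borel, μ(Ω) ≥ 1/2}`. -/
def concentrationFunction (μ : Measure (MatTuple I n)) (F : Finset I) (ε : ℝ) : ℝ≥0∞ :=
  ⨆ (Ω : Set (MatTuple I n)) (_ : MeasurableSet Ω) (_ : 1 / 2 ≤ μ Ω), μ (nhd F ε Ω)ᶜ

open Classical in
/-- The map `A ↦ f(A)` on `{A : ‖Aᵢ‖ ≤ Rᵢ}`, extended by `0`. -/
def apply {R : I → ℝ} {R' : I' → ℝ} (f : FunTuple R R') (A : MatTuple I n) : MatTuple I' n :=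
  if hA : A ∈ box R then f.eval (matrixAlgebra n) A hA else fun _ => 0

/-- The push-forward `f_* μ` of a probability measure `μ` supported on `{A : ‖Aᵢ‖ ≤ Rᵢ}`. -/
def pushforward {R : I → ℝ} {R' : I' → ℝ} (f : FunTuple R R') (μ : Measure (MatTuple I n)) :
    Measure (MatTuple I' n) :=
  μ.map (apply f)

end MatTuple

/-- Exponential concentration at scale `n(k)²`: for every finite `F` and `ε > 0`,
`limsup_k n(k)⁻² log α_{μ^(k)}(F, ε) < 0`, where `log 0 = -∞`. -/
def HasExponentialConcentration {I : Type u} (n : ℕ → ℕ) [∀ k, NeZero (n k)]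
    (μ : ∀ k, Measure (MatTuple I (n k))) : Prop :=
  ∀ (F : Finset I) (ε : ℝ), 0 < ε →
    limsup (fun k => ((1 / (n k : ℝ) ^ 2 : ℝ) : EReal) *
      ENNReal.log (MatTuple.concentrationFunction (μ k) F ε)) atTop < 0

/-- Borel probability measures `μ^(k)` on `M_{n(k)}(ℂ)_sa^I` that satisfy the following with respect
to `P ⊆ M`, the self-adjoint tuple `x` in `M` and the bounds `R`:
(1) `μ^(k)` is supported on `{A : ‖Aᵢ‖ ≤ Rᵢ}`;
(2) `τ_{n(k)}(p(X^(k))) → τ(p(x))` in probability for every non-commutative polynomial `p`;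
(3) exponential concentration at scale `n(k)²`;
(4) `‖E[p(X^(k))]‖₂ → ‖E_P[p(x)]‖₂` for every non-commutative polynomial `p`. -/
structure IsRandomMatrixModel {I : Type u} (M : TracialWStarAlgebra.{u})
    (P : VonNeumannAlgebra M.H) (x : I → selfAdjoint M.Elem) (R : I → ℝ)
    (n : ℕ → ℕ) [∀ k, NeZero (n k)] (μ : ∀ k, Measure (MatTuple I (n k))) : Prop where
  isProbabilityMeasure : ∀ k, IsProbabilityMeasure (μ k)
  operator_norm_bound : ∀ k, μ k (MatTuple.box R)ᶜ = 0
  convergence_in_law : ∀ p : NCPoly I, ∀ ε : ℝ, 0 < ε →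
    Tendsto (fun k => μ k {A | ε ≤ ‖(matrixAlgebra.{u} (n k)).τ
      ((matrixAlgebra.{u} (n k)).evalPoly A p) - M.τ (M.evalPoly x p)‖}) atTop (𝓝 0)
  exponential_concentration : HasExponentialConcentration n μ
  external_averaging : ∀ p : NCPoly I,
    Tendsto (fun k => (matrixAlgebra.{u} (n k)).norm2
      (∫ A, (matrixAlgebra.{u} (n k)).evalPoly A p ∂(μ k))) atTop
      (𝓝 ‖M.condExp P (M.toL2 (M.evalPoly x p))‖)

end

open scoped TensorProduct Topology InnerProductSpace ComplexOrder ENNReal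
open Filter MeasureTheory

noncomputable section

/-! Everything rests on estimates in the `2`-norm that are uniform over all tracial `W^*`-algebras,
hence over all matrix sizes.

Part (a). Let `q` be a polynomial and `f` a tuple in `F_{R,R'}`. The components of `f` are bounded
in operator norm, so `q(f(·))` is again a uniform `2`-norm limit of functions `∑ φⱼ(λ) pⱼ` in `A_R`.
Near the law of `x` the coefficients `φⱼ` are almost constant, and freezing them gives one
polynomial `p` with `q(f(A)) ≈ p(A)` in the `2`-norm, as soon as finitely many moments of `A` are
close to those of `x` (`IsApproximable.exists_poly`). By (2) this fails only with probability
tending to `0`, and there the error is still bounded. So (2) and (4) for `p` pass to `q(f(·))`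
(`IsRandomMatrixModel.pushforward`). Property (1) is the bound built into `F_{R,R'}`. For (3),
functions approximable by `A_R` are uniformly continuous for the `2`-norm, with a modulus
independent of `n`; therefore `f` carries small neighbourhoods into small neighbourhoods and the
concentration function can only decrease (`concentrationFunction_pushforward_le`). The limit
obtained in (4) is `‖E_P[q(y)]‖₂`. Since `q(y)` lies in `Q`, the commuting square hypothesis turns
it into `‖E_{P∩Q}[q(y)]‖₂`.

Part (b) follows once every bounded self-adjoint tuple in `W^*(x)` is shown to be `f(x)` for some
`f` in `F_{R,R'}` (`exists_fun2_eval_eq`). Write `a = r · squash(b)` with `b` self-adjoint and let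
polynomials `pₖ(x)` converge rapidly to `b` in the `2`-norm (`exists_evalPoly_norm_sub_lt`). At
other tuples the `pₖ` need not converge, so each increment is multiplied by a function of the law
that equals `1` at `λ_x` and keeps the increment small everywhere (`exists_lift_of_evalPoly`).
Applying `squash` restores the operator norm bound, and convergence survives because `squash` is
Lipschitz for the `2`-norm (`norm_toL2_cfc_squash_sub_le`). The limits are elements of the algebra
because self-adjoint operator norm balls are `2`-norm complete (`exists_tendsto_toL2`). -/

namespace TracialWStarAlgebra

/-! ### Estimates for the `2`-norm. -/

section TwoNorm

variable (M : TracialWStarAlgebra.{u})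

lemma norm_toL2_le (a : M.Elem) : ‖M.toL2 a‖ ≤ ‖a‖ := by
  rw [norm_toL2]; exact M.norm2_le a

lemma norm_τ_le_norm_toL2 (a : M.Elem) : ‖M.τ a‖ ≤ ‖M.toL2 a‖ := by
  have h := norm_inner_le_norm (𝕜 := ℂ) (M.toL2 1) (M.toL2 a)
  rw [inner_toL2, star_one, one_mul] at h
  have h1 : ‖M.toL2 1‖ = 1 := by
    rw [norm_toL2, norm2, star_one, one_mul, M.unital]; simp
  rwa [h1, one_mul] at h

lemma norm_toL2_star (a : M.Elem) : ‖M.toL2 (star a)‖ = ‖M.toL2 a‖ := by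
  rw [norm_toL2, norm_toL2, norm2, norm2, star_star, M.tracial]

/-- The `2`-norm of `a`, computed from vectors `ξₘ` that represent the trace. -/
lemma hasSum_norm_sq {ξ : ℕ → M.H}
    (h : ∀ a : M.Elem, HasSum (fun m => ⟪ξ m, (a : M.H →L[ℂ] M.H) (ξ m)⟫_ℂ) (M.τ a))
    (a : M.Elem) :
    HasSum (fun m => ‖(a : M.H →L[ℂ] M.H) (ξ m)‖ ^ 2) (‖M.toL2 a‖ ^ 2) := by
  have h1 : ((‖M.toL2 a‖ ^ 2 : ℝ) : ℂ) = M.τ (star a * a) := by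
    rw [← inner_toL2, inner_self_eq_norm_sq_to_K]; push_cast; rfl
  have h2 := h (star a * a)
  rw [← h1] at h2
  rw [← Complex.hasSum_ofReal]
  convert h2 using 2 with m
  simp only [MulMemClass.coe_mul, StarMemClass.coe_star, ContinuousLinearMap.star_eq_adjoint]
  change _ = ⟪ξ m, ContinuousLinearMap.adjoint (a : M.H →L[ℂ] M.H) ((a : M.H →L[ℂ] M.H) (ξ m))⟫_ℂ
  rw [ContinuousLinearMap.adjoint_inner_right, inner_self_eq_norm_sq_to_K]
  push_cast; rfl

lemma norm_toL2_mul_le_left (a b : M.Elem) : ‖M.toL2 (a * b)‖ ≤ ‖a‖ * ‖M.toL2 b‖ := by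
  obtain ⟨ξ, -, h⟩ := M.normal
  refine le_of_sq_le_sq ?_ (by positivity)
  rw [mul_pow]
  refine hasSum_le (fun m => ?_) (M.hasSum_norm_sq h (a * b))
    ((M.hasSum_norm_sq h b).mul_left (‖a‖ ^ 2))
  rw [← mul_pow]
  gcongr
  exact (a : M.H →L[ℂ] M.H).le_opNorm _

/-- Traciality makes the involution isometric for the `2`-norm, which exchanges left and right
multiplication. -/
lemma norm_toL2_mul_le_right (a b : M.Elem) : ‖M.toL2 (a * b)‖ ≤ ‖M.toL2 a‖ * ‖b‖ := by
  rw [← norm_toL2_star, star_mul]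
  refine (M.norm_toL2_mul_le_left _ _).trans ?_
  rw [norm_toL2_star, norm_star, mul_comm]

lemma continuous_toL2 : Continuous M.toL2 :=
  AddMonoidHomClass.continuous_of_bound M.toL2 1 fun a => by
    rw [one_mul]; exact M.norm_toL2_le a

/-- The map `M → L²(M)`, continuous for the operator norm. -/
def toL2CLM : M.Elem →L[ℂ] M.L2 := ⟨M.toL2, M.continuous_toL2⟩

@[simp] lemma toL2CLM_apply (a : M.Elem) : M.toL2CLM a = M.toL2 a := rfl

end TwoNorm

/-! ### Evaluation of `A_R` as an algebra homomorphism, with uniform bounds. -/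

section Ev

variable {I : Type u} {R : I → ℝ}

@[simp] lemma evalPoly_ι (M : TracialWStarAlgebra.{u}) (x : I → selfAdjoint M.Elem) (i : I) :
    M.evalPoly x (FreeAlgebra.ι ℂ i) = x i := by simp [evalPoly]

/-- The constant depends on `R` and `p` alone and thus serves all matrix sizes at once. -/
lemma exists_norm_evalPoly_le (R : I → ℝ) (p : NCPoly I) :
    ∃ C : ℝ, 0 ≤ C ∧ ∀ (M : TracialWStarAlgebra.{u}) (x : I → selfAdjoint M.Elem),
      (∀ i, ‖(x i : M.Elem)‖ ≤ R i) → ‖M.evalPoly x p‖ ≤ C := by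
  induction p using FreeAlgebra.induction with
  | grade0 c =>
    refine ⟨‖c‖, norm_nonneg _, fun M x _ => ?_⟩
    rw [AlgHom.commutes, Algebra.algebraMap_eq_smul_one]
    refine (norm_smul_le _ _).trans (mul_le_of_le_one_right (norm_nonneg _) ?_)
    exact ContinuousLinearMap.norm_id_le
  | grade1 i =>
    exact ⟨|R i|, abs_nonneg _, fun M x hx => by
      rw [evalPoly_ι]; exact (hx i).trans (le_abs_self _)⟩
  | mul p q hp hq =>
    obtain ⟨C, hC0, hC⟩ := hp
    obtain ⟨D, hD0, hD⟩ := hq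
    exact ⟨C * D, by positivity, fun M x hx => by
      rw [map_mul]
      exact (norm_mul_le _ _).trans (mul_le_mul (hC M x hx) (hD M x hx) (norm_nonneg _) hC0)⟩
  | add p q hp hq =>
    obtain ⟨C, hC0, hC⟩ := hp
    obtain ⟨D, hD0, hD⟩ := hq
    exact ⟨C + D, by positivity, fun M x hx => by
      rw [map_add]; exact (norm_add_le _ _).trans (add_le_add (hC M x hx) (hD M x hx))⟩

lemma ev_one (M : TracialWStarAlgebra.{u}) (x : I → selfAdjoint M.Elem)
    (hx : ∀ i, ‖(x i : M.Elem)‖ ≤ R i) : M.ev x hx 1 = 1 := by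
  rw [Algebra.TensorProduct.one_def, ev_tmul]; simp

/-- The evaluation map as a homomorphism of algebras. -/
def evHom (M : TracialWStarAlgebra.{u}) (x : I → selfAdjoint M.Elem)
    (hx : ∀ i, ‖(x i : M.Elem)‖ ≤ R i) : C(NCLaw R, ℂ) ⊗[ℂ] NCPoly I →ₐ[ℂ] M.Elem :=
  AlgHom.ofLinearMap (M.ev x hx) (M.ev_one x hx) (fun f g => by
    induction f using TensorProduct.induction_on with
    | zero => simp
    | add f f' hf hf' => simp only [add_mul, map_add, hf, hf']
    | tmul φ p =>
      induction g using TensorProduct.induction_on with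
      | zero => simp
      | add g g' hg hg' => simp only [mul_add, map_add, hg, hg']
      | tmul ψ q =>
        simp only [Algebra.TensorProduct.tmul_mul_tmul, ev_tmul, ContinuousMap.mul_apply, map_mul,
          smul_mul_smul_comm])

@[simp] lemma evHom_apply (M : TracialWStarAlgebra.{u}) (x : I → selfAdjoint M.Elem)
    (hx : ∀ i, ‖(x i : M.Elem)‖ ≤ R i) (f : C(NCLaw R, ℂ) ⊗[ℂ] NCPoly I) :
    M.evHom x hx f = M.ev x hx f := rfl

/-- The specialization `φ ⊗ p ↦ φ(l) p` at a law `l`. -/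
def specialize (l : NCLaw R) : C(NCLaw R, ℂ) ⊗[ℂ] NCPoly I →ₗ[ℂ] NCPoly I :=
  TensorProduct.lift (LinearMap.mk₂ ℂ (fun φ p => φ l • p)
    (fun φ ψ p => by simp [add_smul]) (fun c φ p => by simp [mul_smul])
    (fun φ p q => by simp) (fun c φ p => by rw [smul_comm]))

@[simp] lemma specialize_tmul (l : NCLaw R) (φ : C(NCLaw R, ℂ)) (p : NCPoly I) :
    specialize l (φ ⊗ₜ p) = φ l • p := rfl

lemma exists_norm_ev_le (g : C(NCLaw R, ℂ) ⊗[ℂ] NCPoly I) :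
    ∃ C : ℝ, 0 ≤ C ∧ ∀ (M : TracialWStarAlgebra.{u}) (x : I → selfAdjoint M.Elem)
      (hx : ∀ i, ‖(x i : M.Elem)‖ ≤ R i), ‖M.ev x hx g‖ ≤ C := by
  induction g using TensorProduct.induction_on with
  | zero => exact ⟨0, le_rfl, fun M x hx => by simp⟩
  | add f g hf hg =>
    obtain ⟨C, hC0, hC⟩ := hf
    obtain ⟨D, hD0, hD⟩ := hg
    exact ⟨C + D, by positivity, fun M x hx => by
      rw [map_add]; exact (norm_add_le _ _).trans (add_le_add (hC M x hx) (hD M x hx))⟩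
  | tmul φ p =>
    obtain ⟨C, hC0, hC⟩ := exists_norm_evalPoly_le R p
    refine ⟨‖φ‖ * C, by positivity, fun M x hx => ?_⟩
    rw [ev_tmul]
    refine (norm_smul_le _ _).trans ?_
    exact mul_le_mul (φ.norm_coe_le_norm _) (hC M x hx) (norm_nonneg _) (norm_nonneg _)

end Ev

end TracialWStarAlgebra

/-! ### Uniform continuity on the space of laws. -/

namespace NCLaw

variable {I : Type u} {R : I → ℝ}

/-- A continuous function on `Σ_R` is uniformly continuous. -/
lemma exists_forall_norm_sub_le (φ : C(NCLaw R, ℂ)) {ε : ℝ} (hε : 0 < ε) :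
    ∃ (Q : Finset (NCPoly I)) (δ : ℝ), 0 < δ ∧ ∀ l l' : NCLaw R,
      (∀ q ∈ Q, ‖l.1 q - l'.1 q‖ < δ) → ‖φ l - φ l'‖ ≤ ε := by
  -- The uniform structure of pointwise convergence induces the given topology, so compactness of
  -- `Σ_R` yields uniform continuity.
  let _ : UniformSpace (NCLaw R) :=
    UniformSpace.comap (fun l : NCLaw R => (l.1 : NCPoly I → ℂ)) inferInstance
  have hφ : UniformContinuous φ := CompactSpace.uniformContinuous_of_continuous φ.continuous
  have h1 := hφ (Metric.dist_mem_uniformity hε)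
  rw [Filter.mem_map, uniformity_comap, Pi.uniformity, Filter.mem_comap] at h1
  obtain ⟨V, hV, hVφ⟩ := h1
  -- An entourage of the product constrains only finitely many coordinates; these are the
  -- polynomials in `Q`, and `δ₀` is the least of their tolerances.
  rw [Filter.mem_iInf] at hV
  obtain ⟨Q, hQ, W, hW, rfl⟩ := hV
  have h2 : ∀ q : Q, ∃ δ > 0, ∀ a b : ℂ, dist a b < δ →
      ∀ u : (NCPoly I → ℂ) × (NCPoly I → ℂ), u.1 q = a → u.2 q = b → u ∈ W q := by
    intro q
    obtain ⟨T, hT, hTW⟩ := Filter.mem_comap.mp (hW q)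
    obtain ⟨δ, hδ, hδT⟩ := Metric.mem_uniformity_dist.mp hT
    refine ⟨δ, hδ, ?_⟩
    rintro _ _ hab u rfl rfl
    exact hTW (hδT hab)
  choose δ hδ0 hδ using h2
  have := hQ.fintype
  have hmin : ∃ δ₀ > 0, ∀ q : Q, δ₀ ≤ δ q := by
    rcases isEmpty_or_nonempty Q with h | h
    · exact ⟨1, one_pos, fun q => h.elim q⟩
    · obtain ⟨q₀, hq₀⟩ := Finite.exists_min δ
      exact ⟨δ q₀, hδ0 q₀, hq₀⟩
  obtain ⟨δ₀, hδ₀, hle⟩ := hmin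
  refine ⟨hQ.toFinset, δ₀, hδ₀, fun l l' hl => ?_⟩
  have h3 : (l, l') ∈ (fun x : NCLaw R × NCLaw R =>
      ((x.1.1 : NCPoly I → ℂ), (x.2.1 : NCPoly I → ℂ))) ⁻¹' ⋂ q, W q := by
    refine Set.mem_iInter.mpr fun q => ?_
    refine hδ q _ _ ?_ _ rfl rfl
    rw [dist_eq_norm]
    exact (hl q (hQ.mem_toFinset.mpr q.2)).trans_le (hle q)
  have h4 := hVφ h3
  rw [← dist_eq_norm]
  exact le_of_lt h4

lemma continuous_eval (p : NCPoly I) : Continuous fun l : NCLaw R => l.1 p :=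
  (_root_.continuous_apply p).comp
    (f := fun l : NCLaw R => (l.1 : NCPoly I → ℂ)) continuous_induced_dom

end NCLaw

/-! ### Approximable and uniformly continuous non-commutative functions. -/

/-- A function that assigns an element of `M` to every self-adjoint tuple `x` in a tracial
`W^*`-algebra `M` with `‖xᵢ‖ ≤ Rᵢ`. -/
abbrev NCFun {I : Type u} (R : I → ℝ) : Type (u + 1) :=
  ∀ (M : TracialWStarAlgebra.{u}) (x : I → selfAdjoint M.Elem),
    (∀ i, ‖(x i : M.Elem)‖ ≤ R i) → M.Elem

namespace NCFun

variable {I : Type u} {R : I → ℝ}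

/-- `F` is bounded in operator norm, uniformly over all tuples. -/
def IsBounded (F : NCFun R) : Prop :=
  ∃ C : ℝ, 0 ≤ C ∧ ∀ (M : TracialWStarAlgebra.{u})
    (x : I → selfAdjoint M.Elem) (hx : ∀ i, ‖(x i : M.Elem)‖ ≤ R i), ‖F M x hx‖ ≤ C

/-- `F` is a limit in `‖·‖_{R,2}` of functions in `A_R`. -/
def IsApproximable (F : NCFun R) : Prop :=
  ∀ ε : ℝ, 0 < ε → ∃ g : C(NCLaw R, ℂ) ⊗[ℂ] NCPoly I, ∀ (M : TracialWStarAlgebra.{u})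
    (x : I → selfAdjoint M.Elem) (hx : ∀ i, ‖(x i : M.Elem)‖ ≤ R i),
    ‖M.toL2 (F M x hx) - M.toL2 (M.ev x hx g)‖ ≤ ε

/-- `F` is uniformly continuous for the `2`-norm. -/
def IsUniformlyContinuous (F : NCFun R) : Prop :=
  ∀ ε : ℝ, 0 < ε → ∃ (S : Finset I) (δ : ℝ), 0 < δ ∧ ∀ (M : TracialWStarAlgebra.{u})
    (x y : I → selfAdjoint M.Elem) (hx : ∀ i, ‖(x i : M.Elem)‖ ≤ R i)
    (hy : ∀ i, ‖(y i : M.Elem)‖ ≤ R i),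
    (∀ i ∈ S, ‖M.toL2 (x i : M.Elem) - M.toL2 (y i : M.Elem)‖ < δ) →
      ‖M.toL2 (F M x hx) - M.toL2 (F M y hy)‖ ≤ ε

lemma isApproximable_ev (g : C(NCLaw R, ℂ) ⊗[ℂ] NCPoly I) :
    IsApproximable (R := R) fun M x hx => M.ev x hx g :=
  fun ε hε => ⟨g, fun M x hx => by simpa using hε.le⟩

lemma IsApproximable.of_limit {F : NCFun R}
    (h : ∀ ε : ℝ, 0 < ε → ∃ G : NCFun R, IsApproximable G ∧ ∀ (M : TracialWStarAlgebra.{u})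
    (x : I → selfAdjoint M.Elem) (hx : ∀ i, ‖(x i : M.Elem)‖ ≤ R i),
      ‖M.toL2 (F M x hx) - M.toL2 (G M x hx)‖ ≤ ε) : IsApproximable F := by
  intro ε hε
  obtain ⟨G, hG, hFG⟩ := h (ε / 2) (by positivity)
  obtain ⟨g, hg⟩ := hG (ε / 2) (by positivity)
  refine ⟨g, fun M x hx => ?_⟩
  have := norm_sub_le_norm_sub_add_norm_sub (M.toL2 (F M x hx)) (M.toL2 (G M x hx))
    (M.toL2 (M.ev x hx g))
  linarith [hFG M x hx, hg M x hx]

lemma IsApproximable.add {F G : NCFun R} (hF : IsApproximable F) (hG : IsApproximable G) :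
    IsApproximable fun M x hx => F M x hx + G M x hx := by
  intro ε hε
  obtain ⟨f, hf⟩ := hF (ε / 2) (by positivity)
  obtain ⟨g, hg⟩ := hG (ε / 2) (by positivity)
  refine ⟨f + g, fun M x hx => ?_⟩
  rw [map_add, map_add, map_add, add_sub_add_comm]
  refine (norm_add_le _ _).trans ?_
  linarith [hf M x hx, hg M x hx]

/-- Splitting `FG - fg = (F - f)G + f(G - g)` needs operator bounds on `G` and `f` only. The
approximant `f` is fixed before `g`, because the accuracy required of `g` depends on the operator
bound of `f`. -/
lemma IsApproximable.mul {F G : NCFun R} (hF : IsApproximable F) (hG : IsApproximable G)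
    (hGb : IsBounded G) : IsApproximable fun M x hx => F M x hx * G M x hx := by
  intro ε hε
  obtain ⟨D, hD0, hD⟩ := hGb
  obtain ⟨f, hf⟩ := hF (ε / (2 * (D + 1))) (by positivity)
  obtain ⟨C, hC0, hC⟩ := TracialWStarAlgebra.exists_norm_ev_le f
  obtain ⟨g, hg⟩ := hG (ε / (2 * (C + 1))) (by positivity)
  refine ⟨f * g, fun M x hx => ?_⟩
  rw [← M.evHom_apply x hx (f * g), map_mul (M.evHom x hx), M.evHom_apply, M.evHom_apply, ← map_sub]
  have h1 : F M x hx * G M x hx - M.ev x hx f * M.ev x hx g =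
      (F M x hx - M.ev x hx f) * G M x hx + M.ev x hx f * (G M x hx - M.ev x hx g) := by
    noncomm_ring
  rw [h1, map_add]
  have h2 := M.norm_toL2_mul_le_right (F M x hx - M.ev x hx f) (G M x hx)
  have h3 := M.norm_toL2_mul_le_left (M.ev x hx f) (G M x hx - M.ev x hx g)
  rw [map_sub] at h2 h3
  have h4 : ‖M.toL2 (F M x hx) - M.toL2 (M.ev x hx f)‖ * ‖G M x hx‖ ≤
      ε / (2 * (D + 1)) * D := mul_le_mul (hf M x hx) (hD M x hx) (norm_nonneg _) (by positivity)
  have h5 : ‖M.ev x hx f‖ * ‖M.toL2 (G M x hx) - M.toL2 (M.ev x hx g)‖ ≤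
      C * (ε / (2 * (C + 1))) := mul_le_mul (hC M x hx) (hg M x hx) (norm_nonneg _) hC0
  have h6 : ε / (2 * (D + 1)) * D ≤ ε / 2 := by
    rw [div_mul_eq_mul_div, div_le_div_iff₀ (by positivity) (by positivity)]
    nlinarith
  have h7 : C * (ε / (2 * (C + 1))) ≤ ε / 2 := by
    rw [mul_div_assoc', div_le_div_iff₀ (by positivity) (by positivity)]
    nlinarith
  refine (norm_add_le _ _).trans ?_
  linarith

lemma IsUniformlyContinuous.of_limit {F : NCFun R}
    (h : ∀ ε : ℝ, 0 < ε → ∃ G : NCFun R, IsUniformlyContinuous G ∧ ∀ (M : TracialWStarAlgebra.{u})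
    (x : I → selfAdjoint M.Elem) (hx : ∀ i, ‖(x i : M.Elem)‖ ≤ R i),
      ‖M.toL2 (F M x hx) - M.toL2 (G M x hx)‖ ≤ ε) : IsUniformlyContinuous F := by
  intro ε hε
  obtain ⟨G, hG, hFG⟩ := h (ε / 3) (by positivity)
  obtain ⟨S, δ, hδ, hS⟩ := hG (ε / 3) (by positivity)
  refine ⟨S, δ, hδ, fun M x y hx hy hxy => ?_⟩
  have h1 := hS M x y hx hy hxy
  have h2 := norm_sub_le_norm_sub_add_norm_sub (M.toL2 (F M x hx)) (M.toL2 (G M x hx))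
    (M.toL2 (F M y hy))
  have h3 := norm_sub_le_norm_sub_add_norm_sub (M.toL2 (G M x hx)) (M.toL2 (G M y hy))
    (M.toL2 (F M y hy))
  have h4 := hFG M y hy
  rw [norm_sub_rev] at h4
  linarith [hFG M x hx]

lemma IsUniformlyContinuous.add {F G : NCFun R} (hF : IsUniformlyContinuous F)
    (hG : IsUniformlyContinuous G) :
    IsUniformlyContinuous fun M x hx => F M x hx + G M x hx := by
  classical
  intro ε hε
  obtain ⟨S, δ, hδ, hS⟩ := hF (ε / 2) (by positivity)
  obtain ⟨T, η, hη, hT⟩ := hG (ε / 2) (by positivity)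
  refine ⟨S ∪ T, min δ η, lt_min hδ hη, fun M x y hx hy hxy => ?_⟩
  have h1 := hS M x y hx hy fun i hi =>
    (hxy i (Finset.mem_union_left _ hi)).trans_le (min_le_left _ _)
  have h2 := hT M x y hx hy fun i hi =>
    (hxy i (Finset.mem_union_right _ hi)).trans_le (min_le_right _ _)
  rw [map_add, map_add, add_sub_add_comm]
  refine (norm_add_le _ _).trans ?_
  linarith

lemma IsUniformlyContinuous.mul {F G : NCFun R} (hF : IsUniformlyContinuous F)
    (hG : IsUniformlyContinuous G) (hFb : IsBounded F) (hGb : IsBounded G) :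
    IsUniformlyContinuous fun M x hx => F M x hx * G M x hx := by
  classical
  intro ε hε
  obtain ⟨C, hC0, hC⟩ := hFb
  obtain ⟨D, hD0, hD⟩ := hGb
  obtain ⟨S, δ, hδ, hS⟩ := hF (ε / (2 * (D + 1))) (by positivity)
  obtain ⟨T, η, hη, hT⟩ := hG (ε / (2 * (C + 1))) (by positivity)
  refine ⟨S ∪ T, min δ η, lt_min hδ hη, fun M x y hx hy hxy => ?_⟩
  have h1 := hS M x y hx hy fun i hi =>
    (hxy i (Finset.mem_union_left _ hi)).trans_le (min_le_left _ _)
  have h2 := hT M x y hx hy fun i hi =>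
    (hxy i (Finset.mem_union_right _ hi)).trans_le (min_le_right _ _)
  have h3 : F M x hx * G M x hx - F M y hy * G M y hy =
      (F M x hx - F M y hy) * G M x hx + F M y hy * (G M x hx - G M y hy) := by
    noncomm_ring
  rw [← map_sub, h3, map_add]
  have h4 := M.norm_toL2_mul_le_right (F M x hx - F M y hy) (G M x hx)
  have h5 := M.norm_toL2_mul_le_left (F M y hy) (G M x hx - G M y hy)
  rw [map_sub] at h4 h5
  have h6 := mul_le_mul h1 (hD M x hx) (norm_nonneg _) (by positivity)
  have h7 := mul_le_mul (hC M y hy) h2 (norm_nonneg _) hC0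
  have h8 : ε / (2 * (D + 1)) * D ≤ ε / 2 := by
    rw [div_mul_eq_mul_div, div_le_div_iff₀ (by positivity) (by positivity)]
    nlinarith
  have h9 : C * (ε / (2 * (C + 1))) ≤ ε / 2 := by
    rw [mul_div_assoc', div_le_div_iff₀ (by positivity) (by positivity)]
    nlinarith
  refine (norm_add_le _ _).trans ?_
  linarith

lemma isUniformlyContinuous_evalPoly (p : NCPoly I) :
    IsUniformlyContinuous (R := R) fun M x _ => M.evalPoly x p := by
  induction p using FreeAlgebra.induction with
  | grade0 c =>
    exact fun ε hε => ⟨∅, 1, one_pos, fun M x y hx hy _ => by simpa using hε.le⟩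
  | grade1 i =>
    refine fun ε hε => ⟨{i}, ε, hε, fun M x y hx hy h => ?_⟩
    simpa using (h i (Finset.mem_singleton_self i)).le
  | mul p q hp hq =>
    simp only [map_mul]
    exact hp.mul hq (TracialWStarAlgebra.exists_norm_evalPoly_le R p)
      (TracialWStarAlgebra.exists_norm_evalPoly_le R q)
  | add p q hp hq => simpa only [map_add] using hp.add hq

lemma norm_smul_one_le (M : TracialWStarAlgebra.{u}) (c : ℂ) : ‖c • (1 : M.Elem)‖ ≤ ‖c‖ :=
  (norm_smul_le _ _).trans (mul_le_of_le_one_right (norm_nonneg _) ContinuousLinearMap.norm_id_le)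

/-- A coefficient `φ(λ_x)` depends, up to `ε`, on finitely many moments of `x`; each moment is
`2`-norm uniformly continuous in `x` because `|τ(a)| ≤ ‖a‖₂`. The remaining factor is a polynomial.
-/
lemma isUniformlyContinuous_ev (g : C(NCLaw R, ℂ) ⊗[ℂ] NCPoly I) :
    IsUniformlyContinuous (R := R) fun M x hx => M.ev x hx g := by
  classical
  induction g using TensorProduct.induction_on with
  | zero => exact fun ε hε => ⟨∅, 1, one_pos, fun M x y hx hy _ => by simpa using hε.le⟩
  | add f g hf hg => simpa only [map_add] using hf.add hg
  | tmul φ p =>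
    have h1 : IsUniformlyContinuous (R := R) fun M x hx => φ (M.law x hx) • (1 : M.Elem) := by
      intro ε hε
      obtain ⟨Q, δ, hδ, hQ⟩ := NCLaw.exists_forall_norm_sub_le φ hε
      have h2 := fun q : NCPoly I => isUniformlyContinuous_evalPoly (R := R) q (δ / 2) (by positivity)
      choose S η hη hS using h2
      have hmin : ∃ η₀ > 0, ∀ q ∈ Q, η₀ ≤ η q := by
        rcases Q.eq_empty_or_nonempty with h | h
        · exact ⟨1, one_pos, fun q hq => by simp [h] at hq⟩
        · obtain ⟨q₀, -, hq₀⟩ := Q.exists_min_image η h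
          exact ⟨η q₀, hη q₀, hq₀⟩
      obtain ⟨η₀, hη₀, hle⟩ := hmin
      refine ⟨Q.biUnion S, η₀, hη₀, fun M x y hx hy hxy => ?_⟩
      have h3 := hQ (M.law x hx) (M.law y hy) fun q hq => by
        have h4 := hS q M x y hx hy fun i hi =>
          (hxy i (Finset.mem_biUnion.mpr ⟨q, hq, hi⟩)).trans_le (hle q hq)
        rw [← map_sub] at h4
        have h5 := (M.norm_τ_le_norm_toL2 _).trans h4
        rw [map_sub] at h5
        exact h5.trans_lt (by linarith)
      rw [← map_sub, ← sub_smul]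
      exact (M.norm_toL2_le _).trans ((norm_smul_one_le _ _).trans h3)
    have h6 := h1.mul (isUniformlyContinuous_evalPoly (R := R) p)
      ⟨‖φ‖, norm_nonneg _, fun M x hx =>
        (norm_smul_one_le _ _).trans (φ.norm_coe_le_norm _)⟩
      (TracialWStarAlgebra.exists_norm_evalPoly_le R p)
    simpa only [TracialWStarAlgebra.ev_tmul, smul_one_mul] using h6

lemma IsApproximable.isUniformlyContinuous {F : NCFun R} (hF : IsApproximable F) :
    IsUniformlyContinuous F :=
  .of_limit fun ε hε => by
    obtain ⟨g, hg⟩ := hF ε hε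
    exact ⟨_, isUniformlyContinuous_ev g, hg⟩

/-- An approximable function is, near a given law, `2`-norm close to a single polynomial. -/
lemma IsApproximable.exists_poly {F : NCFun R} (hF : IsApproximable F) (hFb : IsBounded F)
    (l : NCLaw R) {ε : ℝ} (hε : 0 < ε) :
    ∃ (p : NCPoly I) (Q : Finset (NCPoly I)) (δ C : ℝ), 0 < δ ∧ 0 ≤ C ∧ ∀ (M : TracialWStarAlgebra.{u})
    (x : I → selfAdjoint M.Elem) (hx : ∀ i, ‖(x i : M.Elem)‖ ≤ R i),
      ((∀ q ∈ Q, ‖M.τ (M.evalPoly x q) - l.1 q‖ < δ) →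
        ‖M.toL2 (F M x hx) - M.toL2 (M.evalPoly x p)‖ ≤ ε) ∧
      ‖M.toL2 (F M x hx) - M.toL2 (M.evalPoly x p)‖ ≤ C := by
  classical
  -- For an element of `A_R` the polynomial is obtained by freezing all coefficients at `l`.
  have key : ∀ g : C(NCLaw R, ℂ) ⊗[ℂ] NCPoly I, ∀ ε : ℝ, 0 < ε →
      ∃ (Q : Finset (NCPoly I)) (δ : ℝ), 0 < δ ∧ ∀ (M : TracialWStarAlgebra.{u})
    (x : I → selfAdjoint M.Elem) (hx : ∀ i, ‖(x i : M.Elem)‖ ≤ R i),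
      ((∀ q ∈ Q, ‖M.τ (M.evalPoly x q) - l.1 q‖ < δ) →
        ‖M.toL2 (M.ev x hx g) - M.toL2 (M.evalPoly x (TracialWStarAlgebra.specialize l g))‖
          ≤ ε) := by
    intro g
    induction g using TensorProduct.induction_on with
    | zero => exact fun ε hε => ⟨∅, 1, one_pos, fun M x hx _ => by simpa using hε.le⟩
    | add f g hf hg =>
      intro ε hε
      obtain ⟨Q, δ, hδ, h1⟩ := hf (ε / 2) (by positivity)
      obtain ⟨Q', δ', hδ', h2⟩ := hg (ε / 2) (by positivity)
      refine ⟨Q ∪ Q', min δ δ', lt_min hδ hδ', fun M x hx h => ?_⟩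
      have h3 := h1 M x hx fun q hq =>
        (h q (Finset.mem_union_left _ hq)).trans_le (min_le_left _ _)
      have h4 := h2 M x hx fun q hq =>
        (h q (Finset.mem_union_right _ hq)).trans_le (min_le_right _ _)
      simp only [map_add]
      rw [add_sub_add_comm]
      refine (norm_add_le _ _).trans ?_
      linarith
    | tmul φ p =>
      intro ε hε
      obtain ⟨C, hC0, hC⟩ := TracialWStarAlgebra.exists_norm_evalPoly_le R p
      obtain ⟨Q, δ, hδ, h1⟩ := NCLaw.exists_forall_norm_sub_le φ
        (show 0 < ε / (C + 1) by positivity)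
      refine ⟨Q, δ, hδ, fun M x hx h => ?_⟩
      have h2 := h1 (M.law x hx) l h
      rw [TracialWStarAlgebra.ev_tmul, TracialWStarAlgebra.specialize_tmul, map_smul, map_smul,
        map_smul, ← sub_smul, norm_smul]
      have h3 := mul_le_mul h2 ((M.norm_toL2_le _).trans (hC M x hx)) (norm_nonneg _)
        (by positivity)
      refine h3.trans ?_
      rw [div_mul_eq_mul_div, div_le_iff₀ (by positivity)]
      nlinarith
  obtain ⟨g, hg⟩ := hF (ε / 2) (by positivity)
  obtain ⟨Q, δ, hδ, hQ⟩ := key g (ε / 2) (by positivity)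
  obtain ⟨C, hC0, hC⟩ := hFb
  obtain ⟨D, hD0, hD⟩ := TracialWStarAlgebra.exists_norm_evalPoly_le R
    (TracialWStarAlgebra.specialize l g)
  -- `C + D` is the crude bound, valid for every tuple, that is used later where the law is far from
  -- `l`.
  refine ⟨TracialWStarAlgebra.specialize l g, Q, δ, C + D, hδ, by positivity,
    fun M x hx => ⟨fun h => ?_, ?_⟩⟩
  · have h1 := norm_sub_le_norm_sub_add_norm_sub (M.toL2 (F M x hx)) (M.toL2 (M.ev x hx g))
      (M.toL2 (M.evalPoly x (TracialWStarAlgebra.specialize l g)))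
    linarith [hg M x hx, hQ M x hx h]
  · refine (norm_sub_le _ _).trans (add_le_add ?_ ?_)
    · exact (M.norm_toL2_le _).trans (hC M x hx)
    · exact (M.norm_toL2_le _).trans (hD M x hx)

end NCFun

/-! ### Elements of `F_{R,2}` as functions. -/

namespace Fun2

variable {I : Type u} {R : I → ℝ}

lemma continuous_eval (M : TracialWStarAlgebra.{u}) (x : I → selfAdjoint M.Elem)
    (hx : ∀ i, ‖(x i : M.Elem)‖ ≤ R i) : Continuous (eval M x hx) :=
  UniformSpace.Completion.continuous_extension

lemma norm_eval_sub_le (M : TracialWStarAlgebra.{u}) (x : I → selfAdjoint M.Elem)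
    (hx : ∀ i, ‖(x i : M.Elem)‖ ≤ R i) (f g : Fun2 R) :
    ‖eval M x hx f - eval M x hx g‖ ≤ ‖f - g‖ := by
  induction f, g using UniformSpace.Completion.induction_on₂ with
  | hp =>
    have := continuous_eval M x hx
    exact isClosed_le (by fun_prop) (by fun_prop)
  | ih f g =>
    rw [eval_coe, eval_coe, ← map_sub, ← map_sub, ← UniformSpace.Completion.coe_sub,
      UniformSpace.Completion.norm_coe]
    exact FunA.norm_eval_le M x hx _

lemma exists_approx (f : Fun2 R) {ε : ℝ} (hε : 0 < ε) :
    ∃ g : C(NCLaw R, ℂ) ⊗[ℂ] NCPoly I, ∀ (M : TracialWStarAlgebra.{u})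
    (x : I → selfAdjoint M.Elem) (hx : ∀ i, ‖(x i : M.Elem)‖ ≤ R i),
      ‖eval M x hx f - M.toL2 (M.ev x hx g)‖ ≤ ε := by
  obtain ⟨g, hg⟩ := UniformSpace.Completion.denseRange_coe.exists_dist_lt f hε
  refine ⟨g, fun M x hx => ?_⟩
  have h := norm_eval_sub_le M x hx f (g : Fun2 R)
  rw [eval_coe] at h
  refine h.trans ?_
  rw [← dist_eq_norm]
  exact hg.le

/-- A function that is approximable by `A_R` is the evaluation of an element of `F_{R,2}`. -/
lemma exists_eval_eq {F : NCFun R} (hF : F.IsApproximable) :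
    ∃ f : Fun2 R, ∀ (M : TracialWStarAlgebra.{u})
    (x : I → selfAdjoint M.Elem) (hx : ∀ i, ‖(x i : M.Elem)‖ ≤ R i), eval M x hx f = M.toL2 (F M x hx) := by
  choose g hg using fun n : ℕ => hF ((1 / 2) ^ n) (by positivity)
  have hc : CauchySeq fun n => ((show FunA R from g n : FunA R) : Fun2 R) := by
    -- Approximants within `2⁻ⁿ` and `2⁻ⁿ⁻¹` of `F` differ by at most `(3/2) 2⁻ⁿ`, uniformly over
    -- all tuples; `2` is a convenient upper bound for `3/2`.
    refine cauchySeq_of_le_geometric (1 / 2) 2 (by norm_num) fun n => ?_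
    rw [dist_eq_norm, ← UniformSpace.Completion.coe_sub, UniformSpace.Completion.norm_coe]
    refine Real.sSup_le ?_ (by positivity)
    rintro _ ⟨M, x, hx, rfl⟩
    rw [map_sub, map_sub]
    have h1 := norm_sub_le_norm_sub_add_norm_sub (M.toL2 (M.ev x hx (g n)))
      (M.toL2 (F M x hx)) (M.toL2 (M.ev x hx (g (n + 1))))
    have h2 := hg n M x hx
    rw [norm_sub_rev] at h2
    have h3 := hg (n + 1) M x hx
    rw [pow_succ] at h3
    have h4 : (0 : ℝ) ≤ (1 / 2) ^ n := by positivity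
    refine h1.trans ?_
    linarith
  obtain ⟨f, hf⟩ := cauchySeq_tendsto_of_complete hc
  refine ⟨f, fun M x hx => ?_⟩
  have h1 := ((continuous_eval M x hx).tendsto f).comp hf
  refine tendsto_nhds_unique h1 ?_
  rw [tendsto_iff_norm_sub_tendsto_zero]
  refine squeeze_zero (fun _ => norm_nonneg _) (fun n => ?_)
    (tendsto_pow_atTop_nhds_zero_of_lt_one (r := (1 / 2 : ℝ)) (by norm_num) (by norm_num))
  rw [Function.comp_apply, eval_coe, norm_sub_rev]
  exact hg n M x hx

end Fun2

/-! ### Polynomials in a tuple of `F_{R,R'}`. -/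

namespace FunTuple

variable {I I' : Type u} {R : I → ℝ} {R' : I' → ℝ}

lemma norm_eval_le (f : FunTuple R R') (M : TracialWStarAlgebra.{u}) (x : I → selfAdjoint M.Elem)
    (hx : ∀ i, ‖(x i : M.Elem)‖ ≤ R i) (i : I') : ‖(f.eval M x hx i : M.Elem)‖ ≤ R' i :=
  (f.2 i M x hx).choose_spec.2

lemma isApproximable_eval (f : FunTuple R R') (i : I') :
    NCFun.IsApproximable (R := R) fun M x hx => (f.eval M x hx i : M.Elem) := by
  intro ε hε
  obtain ⟨g, hg⟩ := (f.1 i).exists_approx hε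
  exact ⟨g, fun M x hx => by rw [f.toL2_eval]; exact hg M x hx⟩

lemma isBounded_evalPoly (f : FunTuple R R') (q : NCPoly I') :
    NCFun.IsBounded (R := R) fun M x hx => M.evalPoly (f.eval M x hx) q := by
  obtain ⟨C, hC0, hC⟩ := TracialWStarAlgebra.exists_norm_evalPoly_le R' q
  exact ⟨C, hC0, fun M x hx => hC M _ (f.norm_eval_le M x hx)⟩

/-- Approximable functions are closed under products with bounded ones, and the bounds `R'` make
every polynomial in `f` bounded. -/
lemma isApproximable_evalPoly (f : FunTuple R R') (q : NCPoly I') :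
    NCFun.IsApproximable (R := R) fun M x hx => M.evalPoly (f.eval M x hx) q := by
  induction q using FreeAlgebra.induction with
  | grade0 c =>
    convert NCFun.isApproximable_ev (R := R)
      (algebraMap ℂ (C(NCLaw R, ℂ) ⊗[ℂ] NCPoly I) c) using 4 with M x hx
    rw [AlgHom.commutes, ← M.evHom_apply, AlgHom.commutes]
  | grade1 i => simpa using f.isApproximable_eval i
  | mul p q hp hq => simpa only [map_mul] using hp.mul hq (f.isBounded_evalPoly q)
  | add p q hp hq => simpa only [map_add] using hp.add hq

end FunTuple

/-! ### Conditional expectations and passage to a subalgebra. -/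

namespace TracialWStarAlgebra

variable (M : TracialWStarAlgebra.{u})

/-- The inclusion of a `W^*`-subalgebra. -/
def incl (Q : VonNeumannAlgebra M.H) (hQ : Q ≤ M.alg) : (M.sub Q hQ).Elem →⋆ₐ[ℂ] M.Elem :=
  StarSubalgebra.inclusion (S₁ := Q.toStarSubalgebra) (S₂ := M.alg.toStarSubalgebra) hQ

lemma incl_evalPoly_generators {I : Type u} (y : I → selfAdjoint M.Elem) (q : NCPoly I) :
    M.incl (M.wStar y) (M.wStar_le y) ((M.generated y).evalPoly (M.generators y) q) =
      M.evalPoly y q := by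
  have : ((M.incl (M.wStar y) (M.wStar_le y)).toAlgHom.comp
      ((M.generated y).evalPoly (M.generators y))) = M.evalPoly y := by
    apply FreeAlgebra.hom_ext
    funext i
    change M.incl (M.wStar y) (M.wStar_le y)
      ((M.generated y).evalPoly (M.generators y) (FreeAlgebra.ι ℂ i)) = _
    rw [evalPoly_ι, Function.comp_apply, evalPoly_ι]
    rfl
  exact DFunLike.congr_fun this q

lemma evalPoly_mem_wStar {I : Type u} (y : I → selfAdjoint M.Elem) (q : NCPoly I) :
    (M.evalPoly y q : M.H →L[ℂ] M.H) ∈ M.wStar y := by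
  rw [← M.incl_evalPoly_generators]
  exact ((M.generated y).evalPoly (M.generators y) q).2

lemma isometry_toL2 : Isometry fun a : M.PreL2 => M.toL2 (M.toPreL2.symm a) :=
  (UniformSpace.Completion.toComplₗᵢ (𝕜 := ℂ) (E := M.PreL2)).isometry

lemma norm_condExp_le (P : VonNeumannAlgebra M.H) (v : M.L2) : ‖M.condExp P v‖ ≤ ‖v‖ := by
  have : CompleteSpace (M.L2Sub P) :=
    (Submodule.isClosed_topologicalClosure _).completeSpace_coe
  exact Submodule.norm_starProjection_apply_le _ _

/-- Pythagoras, with the distance to `L²(P)` computed before completion as the distance to `P`. In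
this form the norm can be compared between different ambient algebras without relating their `L²`
spaces. -/
lemma norm_condExp_sq (P : VonNeumannAlgebra M.H) (a : M.PreL2) :
    ‖M.condExp P (M.toL2 (M.toPreL2.symm a))‖ ^ 2 = ‖a‖ ^ 2 -
      Metric.infDist a {b | ((M.toPreL2.symm b : M.Elem) : M.H →L[ℂ] M.H) ∈ P} ^ 2 := by
  have : CompleteSpace (M.L2Sub P) :=
    (Submodule.isClosed_topologicalClosure _).completeSpace_coe
  set v := M.toL2 (M.toPreL2.symm a) with hv
  have h1 : ‖v‖ = ‖a‖ := UniformSpace.Completion.norm_coe a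
  have h2 : ‖v‖ ^ 2 = ‖M.condExp P v‖ ^ 2 + ‖v - M.condExp P v‖ ^ 2 := by
    have h3 := norm_add_sq_eq_norm_sq_add_norm_sq_of_inner_eq_zero (𝕜 := ℂ)
      (M.condExp P v) (v - M.condExp P v)
      (Submodule.inner_right_of_mem_orthogonal (Submodule.starProjection_apply_mem (M.L2Sub P) v)
        (Submodule.sub_starProjection_mem_orthogonal v))
    rw [add_sub_cancel] at h3
    simpa [sq] using h3
  have h3 : ‖v - M.condExp P v‖ = Metric.infDist v (M.L2Sub P : Set M.L2) := by
    rw [Metric.infDist_eq_iInf]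
    simp only [dist_eq_norm]
    exact Submodule.starProjection_minimal (U := M.L2Sub P) v
  have h4 : Metric.infDist v (M.L2Sub P : Set M.L2) =
      Metric.infDist a {b | ((M.toPreL2.symm b : M.Elem) : M.H →L[ℂ] M.H) ∈ P} := by
    rw [← Metric.infDist_image M.isometry_toL2, L2Sub, Submodule.topologicalClosure_coe,
      Metric.infDist_closure]
    rfl
  rw [← h1, ← h4, ← h3, h2]
  ring

/-- The inclusion of `Q` in `M` is isometric for the `2`-norms and, since `P ⊆ Q`, maps `P` onto
`P`. Hence both norms are given by the same distance. -/
lemma norm_condExp_sub (Q : VonNeumannAlgebra M.H) (hQ : Q ≤ M.alg) (P : VonNeumannAlgebra M.H)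
    (hP : P ≤ Q) (a : (M.sub Q hQ).Elem) :
    ‖(M.sub Q hQ).condExp P ((M.sub Q hQ).toL2 a)‖ =
      ‖M.condExp P (M.toL2 (M.incl Q hQ a))‖ := by
  let N := M.sub Q hQ
  let j : N.PreL2 → M.PreL2 := fun b => M.toPreL2 (M.incl Q hQ (N.toPreL2.symm b))
  have hn : ∀ b : N.PreL2, ‖j b‖ = ‖b‖ := by
    intro b
    have e1 : ‖M.toL2 (M.incl Q hQ (N.toPreL2.symm b))‖ = ‖j b‖ :=
      UniformSpace.Completion.norm_coe (j b)
    have e2 : ‖N.toL2 (N.toPreL2.symm b)‖ = ‖b‖ := UniformSpace.Completion.norm_coe b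
    rw [← e1, ← e2, norm_toL2, norm_toL2]
    rfl
  have hj : Isometry j := by
    refine Isometry.of_dist_eq fun b c => ?_
    rw [dist_eq_norm, dist_eq_norm, ← hn (b - c)]
    simp [j]
  have h1 := N.norm_condExp_sq P (N.toPreL2 a)
  have h2 := M.norm_condExp_sq P (j (N.toPreL2 a))
  have h3 : {b : M.PreL2 | ((M.toPreL2.symm b : M.Elem) : M.H →L[ℂ] M.H) ∈ P} =
      j '' {b | ((N.toPreL2.symm b).1 : M.H →L[ℂ] M.H) ∈ P} := by
    ext b
    constructor
    · intro hb
      exact ⟨N.toPreL2 ⟨((M.toPreL2.symm b : M.Elem) : M.H →L[ℂ] M.H), hP hb⟩, hb, rfl⟩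
    · rintro ⟨c, hc, rfl⟩
      exact hc
  rw [h3, Metric.infDist_image hj, hn] at h2
  exact (sq_eq_sq₀ (norm_nonneg _) (norm_nonneg _)).mp (h1.trans h2.symm)

lemma condExp_of_mem (P : VonNeumannAlgebra M.H) (a : M.Elem) (ha : (a : M.H →L[ℂ] M.H) ∈ P) :
    M.condExp P (M.toL2 a) = M.toL2 a :=
  M.condExp_toL2_eq P a a ha fun _ _ => rfl

end TracialWStarAlgebra

instance (n : ℕ) [NeZero n] : FiniteDimensional ℂ (matrixAlgebra.{u} n).Elem :=
  FiniteDimensional.of_injective (V₂ := CSpace.{u} n →L[ℂ] CSpace.{u} n)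
    (allOperators (CSpace.{u} n)).toStarSubalgebra.toSubalgebra.toSubmodule.subtype
    Subtype.val_injective

/-! ### Matrix tuples: measurability and concentration of push-forwards. -/

namespace MatTuple

variable {I I' : Type u} {n : ℕ} [NeZero n] {R : I → ℝ} {R' : I' → ℝ}

lemma continuous_coord (i : I) :
    Continuous fun A : MatTuple I n => (A i : (matrixAlgebra.{u} n).Elem) :=
  continuous_subtype_val.comp (continuous_apply i)

lemma continuous_evalPoly (p : NCPoly I) :
    Continuous fun A : MatTuple I n => (matrixAlgebra.{u} n).evalPoly A p := by
  induction p using FreeAlgebra.induction with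
  | grade0 c => simp only [AlgHom.commutes]; exact continuous_const
  | grade1 i =>
    have : (fun A : MatTuple I n => (matrixAlgebra.{u} n).evalPoly A (FreeAlgebra.ι ℂ i)) =
        fun A => (A i : (matrixAlgebra.{u} n).Elem) :=
      funext fun A => (matrixAlgebra.{u} n).evalPoly_ι A i
    rw [this]
    exact continuous_coord i
  | mul p q hp hq => simp only [map_mul]; exact hp.mul hq
  | add p q hp hq => simp only [map_add]; exact hp.add hq

lemma isClosed_box : IsClosed (box R : Set (MatTuple I n)) := by
  have : (box R : Set (MatTuple I n)) =
      ⋂ i, {A | ‖(A i : (matrixAlgebra.{u} n).Elem)‖ ≤ R i} := by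
    ext; simp [box]
  rw [this]
  exact isClosed_iInter fun i => isClosed_le (continuous_coord i).norm continuous_const

lemma isOpen_nhd (F : Finset I) (ε : ℝ) (Ω : Set (MatTuple I n)) : IsOpen (nhd F ε Ω) := by
  have : nhd F ε Ω = ⋃ A ∈ Ω, ⋂ i ∈ F, {B | (matrixAlgebra.{u} n).norm2 (A i - B i) < ε} := by
    ext; simp [nhd]
  rw [this]
  refine isOpen_biUnion fun A _ => isOpen_biInter_finset fun i _ => ?_
  simp only [← TracialWStarAlgebra.norm_toL2]
  exact isOpen_lt (((matrixAlgebra.{u} n).continuous_toL2.comp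
    (continuous_const.sub (continuous_coord i))).norm) continuous_const

lemma apply_of_mem (f : FunTuple R R') {A : MatTuple I n} (hA : A ∈ box R) :
    apply f A = f.eval (matrixAlgebra n) A hA := dif_pos hA

/-- Uniform continuity controls the `2`-norm of the increments; in the finite-dimensional matrix
algebra this norm is equivalent to the operator norm, with the constant `K` below allowed to depend
on `n`. -/
lemma continuousOn_apply (f : FunTuple R R') :
    ContinuousOn (apply f : MatTuple I n → MatTuple I' n) (box R) := by
  obtain ⟨K, hK, hanti⟩ := LinearMap.exists_antilipschitzWith (matrixAlgebra.{u} n).toL2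
    (LinearMap.ker_eq_bot.mpr (matrixAlgebra.{u} n).toL2_injective)
  refine continuousOn_pi (X := fun _ => selfAdjoint (matrixAlgebra.{u} n).Elem) |>.mpr fun j => ?_
  rw [Topology.IsInducing.subtypeVal.continuousOn_iff]
  intro A hA
  rw [ContinuousWithinAt, Metric.tendsto_nhds]
  intro ε hε
  obtain ⟨S, δ, hδ, hS⟩ := (f.isApproximable_eval j).isUniformlyContinuous (ε / (2 * K))
    (by positivity)
  have hev : ∀ᶠ B : MatTuple I n in 𝓝[box R] A, ∀ i ∈ S,
      ‖(B i : (matrixAlgebra.{u} n).Elem) - A i‖ < δ := by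
    refine (Filter.eventually_all_finset S).mpr fun i _ => ?_
    have h1 := (((continuous_coord (n := n) i).tendsto A).mono_left
      (nhdsWithin_le_nhds (s := box R))).eventually (Metric.ball_mem_nhds _ hδ)
    filter_upwards [h1] with B hB
    rwa [← dist_eq_norm]
  filter_upwards [hev, self_mem_nhdsWithin] with B hB hBbox
  have h2 := hS (matrixAlgebra n) B A hBbox hA fun i hi => by
    rw [← map_sub]
    exact ((matrixAlgebra n).norm_toL2_le _).trans_lt (hB i hi)
  rw [Function.comp_apply, Function.comp_apply, apply_of_mem f hBbox, apply_of_mem f hA]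
  have h3 := hanti.le_mul_dist (f.eval (matrixAlgebra n) B hBbox j : (matrixAlgebra n).Elem)
    (f.eval (matrixAlgebra n) A hA j)
  rw [dist_eq_norm ((matrixAlgebra n).toL2 _)] at h3
  have hK' : (0 : ℝ) < K := by exact_mod_cast hK
  calc dist _ _ ≤ _ := h3
    _ ≤ K * (ε / (2 * K)) := by gcongr
    _ = ε / 2 := by field_simp
    _ < ε := by linarith

/-- For uncountable index sets the Borel `σ`-algebra may exceed the product `σ`-algebra, so
coordinatewise measurability would not be enough. Continuity on the closed box, and constancy off
it, give Borel measurability directly. -/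
lemma measurable_apply (f : FunTuple R R') :
    Measurable (apply f : MatTuple I n → MatTuple I' n) := by
  classical
  obtain ⟨z, hz⟩ : ∃ z : MatTuple I' n, z = fun _ => 0 := ⟨_, rfl⟩
  have h := ContinuousOn.measurable_piecewise (continuousOn_apply (n := n) f)
    (continuousOn_const (c := z)) isClosed_box.measurableSet
  convert h using 1
  funext A
  by_cases hA : A ∈ (box R : Set (MatTuple I n))
  · rw [Set.piecewise_eq_of_mem _ _ _ hA]
  · rw [Set.piecewise_eq_of_notMem _ _ _ hA]
    exact (dif_neg hA).trans hz.symm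

lemma apply_mem_box (f : FunTuple R R') {A : MatTuple I n} (hA : A ∈ box R) :
    apply f A ∈ box R' := by
  intro i
  rw [apply_of_mem f hA]
  exact f.norm_eval_le _ _ _ i

/-- If `B` is `(S, δ)`-close to a point `A` of the box with `f(A) ∈ Ω`, then `f(B)` is `(S',
ε)`-close to `Ω`. Thus the preimage of the complement of a neighbourhood of `Ω` avoids a
neighbourhood of the preimage of `Ω`. The pair `(S, δ)` is chosen before `n`, as the exponential
rate requires. -/
lemma concentrationFunction_pushforward_le (f : FunTuple R R') (S' : Finset I') {ε : ℝ}
    (hε : 0 < ε) : ∃ (S : Finset I) (δ : ℝ), 0 < δ ∧ ∀ (n : ℕ) [NeZero n]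
      (μ : Measure (MatTuple I n)), μ (box R)ᶜ = 0 →
      concentrationFunction (pushforward f μ) S' ε ≤ concentrationFunction μ S δ := by
  classical
  choose S δ hδ hS using fun j : I' =>
    (f.isApproximable_eval j).isUniformlyContinuous (ε / 2) (by positivity)
  have hmin : ∃ δ₀ > 0, ∀ j ∈ S', δ₀ ≤ δ j := by
    rcases S'.eq_empty_or_nonempty with h | h
    · exact ⟨1, one_pos, fun q hq => by simp [h] at hq⟩
    · obtain ⟨q₀, -, hq₀⟩ := S'.exists_min_image δ h
      exact ⟨δ q₀, hδ q₀, hq₀⟩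
  obtain ⟨δ₀, hδ₀, hle⟩ := hmin
  refine ⟨S'.biUnion S, δ₀, hδ₀, fun n _ μ hμ => ?_⟩
  refine iSup_le fun Ω => iSup_le fun hΩ => iSup_le fun hΩ2 => ?_
  have hm := measurable_apply (n := n) f
  rw [pushforward, Measure.map_apply hm hΩ] at hΩ2
  rw [pushforward, Measure.map_apply hm (isOpen_nhd _ _ _).measurableSet.compl]
  have hbox : ∀ T : Set (MatTuple I n), μ (T ∩ box R) = μ T := fun T =>
    measure_inter_conull hμ
  refine le_trans ?_ (le_iSup₂_of_le (apply f ⁻¹' Ω ∩ box R)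
    ((hm hΩ).inter isClosed_box.measurableSet) (le_iSup_of_le (by rwa [hbox]) le_rfl))
  rw [← hbox]
  refine measure_mono ?_
  rintro B ⟨hB, hBbox⟩ ⟨A, ⟨hA, hAbox⟩, hAB⟩
  refine hB ⟨apply f A, hA, fun j hj => ?_⟩
  rw [apply_of_mem f hAbox, apply_of_mem f hBbox, ← TracialWStarAlgebra.norm_toL2, map_sub]
  refine (hS j (matrixAlgebra n) A B hAbox hBbox fun i hi => ?_).trans_lt (by linarith)
  rw [← map_sub, TracialWStarAlgebra.norm_toL2]
  exact (hAB i (Finset.mem_biUnion.mpr ⟨j, hj, hi⟩)).trans_le (hle j hj)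

end MatTuple

lemma norm_integral_le_add_of_bad_set {α E : Type*} [MeasurableSpace α] [NormedAddCommGroup E]
    [NormedSpace ℝ E] (μ : Measure α) [IsProbabilityMeasure μ] (D : α → E) {ε C : ℝ} (hε : 0 ≤ ε)
    (bad : Set α) (hbad : MeasurableSet bad) (h : ∀ᵐ a ∂μ, (a ∉ bad → ‖D a‖ ≤ ε) ∧ ‖D a‖ ≤ C) :
    ‖∫ a, D a ∂μ‖ ≤ ε + C * μ.real bad := by
  have hi : Integrable (fun a => ε + bad.indicator (fun _ => C) a) μ :=
    (integrable_const ε).add ((integrable_const C).indicator hbad)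
  refine (norm_integral_le_of_norm_le hi ?_).trans_eq ?_
  · filter_upwards [h] with a ha
    by_cases hab : a ∈ bad
    · rw [Set.indicator_of_mem hab]
      linarith [ha.2]
    · rw [Set.indicator_of_notMem hab, add_zero]
      exact ha.1 hab
  · rw [integral_add (integrable_const ε) ((integrable_const C).indicator hbad),
      integral_indicator hbad]
    simp [mul_comm]

/-! ### Transfer of random matrix models along `f`. -/

namespace IsRandomMatrixModel

variable {I I' : Type u} {M : TracialWStarAlgebra.{u}} {P : VonNeumannAlgebra M.H}
  {x : I → selfAdjoint M.Elem} {R : I → ℝ} {R' : I' → ℝ} {n : ℕ → ℕ} [∀ k, NeZero (n k)]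
  {μ : ∀ k, Measure (MatTuple I (n k))}

/-- The matrix tuples whose law is not `δ`-close to that of `x` on a finite set of polynomials. -/
def badSet {I : Type u} (M : TracialWStarAlgebra.{u}) (x : I → selfAdjoint M.Elem) (n : ℕ)
    [NeZero n] (Q : Finset (NCPoly I)) (δ : ℝ) : Set (MatTuple I n) :=
  ⋃ q ∈ Q, {A | δ ≤ ‖(matrixAlgebra.{u} n).τ ((matrixAlgebra.{u} n).evalPoly A q) -
    M.τ (M.evalPoly x q)‖}

lemma lt_of_notMem_badSet {n : ℕ} [NeZero n] {Q : Finset (NCPoly I)} {δ : ℝ} {A : MatTuple I n}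
    (hA : A ∉ badSet M x n Q δ) {q : NCPoly I} (hq : q ∈ Q) :
    ‖(matrixAlgebra.{u} n).τ ((matrixAlgebra.{u} n).evalPoly A q) -
      M.τ (M.evalPoly x q)‖ < δ := by
  by_contra! h
  exact hA (Set.mem_biUnion (x := q) hq h)

lemma isClosed_law {n : ℕ} [NeZero n] (q : NCPoly I) (c : ℂ) (δ : ℝ) :
    IsClosed {A : MatTuple I n | δ ≤ ‖(matrixAlgebra.{u} n).τ
      ((matrixAlgebra.{u} n).evalPoly A q) - c‖} :=
  isClosed_le continuous_const
    ((((matrixAlgebra.{u} n).τ.continuous_of_finiteDimensional.comp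
      (MatTuple.continuous_evalPoly q)).sub continuous_const).norm)

lemma measurableSet_badSet {n : ℕ} [NeZero n] (Q : Finset (NCPoly I)) (δ : ℝ) :
    MeasurableSet (badSet M x n Q δ) :=
  Finset.measurableSet_biUnion Q fun q _ => (isClosed_law q _ δ).measurableSet

lemma tendsto_badSet (h : IsRandomMatrixModel M P x R n μ) (Q : Finset (NCPoly I)) {δ : ℝ}
    (hδ : 0 < δ) : Tendsto (fun k => μ k (badSet M x (n k) Q δ)) atTop (𝓝 0) := by
  have h1 : Tendsto (fun k => ∑ q ∈ Q, μ k {A | δ ≤ ‖(matrixAlgebra.{u} (n k)).τ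
      ((matrixAlgebra.{u} (n k)).evalPoly A q) - M.τ (M.evalPoly x q)‖}) atTop
      (𝓝 (∑ _q ∈ Q, 0)) := tendsto_finsetSum Q fun q _ => h.convergence_in_law q δ hδ
  rw [Finset.sum_const_zero] at h1
  exact tendsto_of_tendsto_of_tendsto_of_le_of_le tendsto_const_nhds h1 (fun _ => zero_le)
    fun k => measure_biUnion_finset_le Q _

/-- The push-forward of a random matrix model for `x` is one for every tuple `y` that has the law of
`f(x)` and conditional expectations of the same `2`-norms. -/
theorem pushforward (h : IsRandomMatrixModel M P x R n μ) (hx : ∀ i, ‖(x i : M.Elem)‖ ≤ R i)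
    (f : FunTuple R R') {N : TracialWStarAlgebra.{u}} (P' : VonNeumannAlgebra N.H)
    (y : I' → selfAdjoint N.Elem)
    (hτ : ∀ q, N.τ (N.evalPoly y q) = M.τ (M.evalPoly (f.eval M x hx) q))
    (hE : ∀ q, ‖N.condExp P' (N.toL2 (N.evalPoly y q))‖ =
      ‖M.condExp P (M.toL2 (M.evalPoly (f.eval M x hx) q))‖) :
    IsRandomMatrixModel N P' y R' n (fun k => MatTuple.pushforward f (μ k)) := by
  classical
  have hprob := h.isProbabilityMeasure
  have hm := fun k => MatTuple.measurable_apply (n := n k) f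
  have hbox : ∀ k, ∀ᵐ A ∂(μ k), A ∈ MatTuple.box R := fun k => h.operator_norm_bound k
  refine ⟨fun k => Measure.isProbabilityMeasure_map (hm k).aemeasurable, fun k => ?_,
    fun q ε hε => ?_, fun S' ε hε => ?_, fun q => ?_⟩
  · rw [MatTuple.pushforward, Measure.map_apply (hm k) MatTuple.isClosed_box.measurableSet.compl]
    refine measure_mono_null ?_ (h.operator_norm_bound k)
    exact fun A hA hAbox => hA (MatTuple.apply_mem_box f hAbox)
  · obtain ⟨p, Q, δ, C, hδ, -, hpQ⟩ := (f.isApproximable_evalPoly q).exists_poly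
      (f.isBounded_evalPoly q) (M.law x hx) (show 0 < ε / 4 by positivity)
    -- Besides `Q`, the moment of `p` itself is controlled. The errors are `ε/4` for replacing
    -- `q(f(A))` by `p(A)`, `ε/4` for the moment of `p`, and `ε/4` for returning to `q(f(x))`.
    have h1 := h.tendsto_badSet (insert p Q) (lt_min hδ (show 0 < ε / 4 by positivity))
    refine tendsto_of_tendsto_of_tendsto_of_le_of_le tendsto_const_nhds h1 (fun _ => zero_le)
      fun k => ?_
    rw [MatTuple.pushforward, Measure.map_apply (hm k) (isClosed_law q _ ε).measurableSet]
    refine measure_mono_ae ?_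
    filter_upwards [hbox k] with A hA hAε
    by_contra hbad
    have h2 : ε ≤ ‖(matrixAlgebra.{u} (n k)).τ ((matrixAlgebra.{u} (n k)).evalPoly
        (MatTuple.apply f A) q) - N.τ (N.evalPoly y q)‖ := hAε
    rw [MatTuple.apply_of_mem f hA, hτ] at h2
    have h3 := (hpQ (matrixAlgebra (n k)) A hA).1 fun q hq =>
      (lt_of_notMem_badSet hbad (Finset.mem_insert_of_mem hq)).trans_le (min_le_left _ _)
    -- The tuple `x` is itself admissible, since its moments differ from those of its own law by
    -- `0`.
    have h4 := (hpQ M x hx).1 fun q hq => by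
      change ‖M.τ (M.evalPoly x q) - M.τ (M.evalPoly x q)‖ < δ
      simpa using hδ
    have h5 := (lt_of_notMem_badSet hbad (Finset.mem_insert_self p Q)).trans_le (min_le_right _ _)
    rw [← map_sub] at h3 h4
    have h6 := ((matrixAlgebra.{u} (n k)).norm_τ_le_norm_toL2 _).trans h3
    have h7 := (M.norm_τ_le_norm_toL2 _).trans h4
    rw [map_sub] at h6 h7
    rw [norm_sub_rev] at h7
    have h8 := dist_triangle4 ((matrixAlgebra.{u} (n k)).τ ((matrixAlgebra.{u} (n k)).evalPoly
      (f.eval (matrixAlgebra (n k)) A hA) q)) ((matrixAlgebra.{u} (n k)).τ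
      ((matrixAlgebra.{u} (n k)).evalPoly A p)) (M.τ (M.evalPoly x p))
      (M.τ (M.evalPoly (f.eval M x hx) q))
    simp only [dist_eq_norm] at h8
    linarith
  · obtain ⟨S, δ, hδ, hle⟩ := MatTuple.concentrationFunction_pushforward_le f S' hε
    refine lt_of_le_of_lt (limsup_le_limsup (.of_forall fun k => ?_))
      (h.exponential_concentration S δ hδ)
    refine mul_le_mul_of_nonneg_left (ENNReal.log_monotone (hle (n k) (μ k)
      (h.operator_norm_bound k))) ?_
    exact_mod_cast (by positivity : (0 : ℝ) ≤ 1 / (n k : ℝ) ^ 2)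
  · rw [hE, Metric.tendsto_atTop]
    intro η hη
    -- The budget `η` is split into four: replacing `q(f(A))` by `p(A)` on good laws, the bad set,
    -- (4) for `p`, and replacing `p(x)` by `q(f(x))` under the contraction `E_P`.
    obtain ⟨p, Q, δ, C, hδ, hC0, hpQ⟩ := (f.isApproximable_evalPoly q).exists_poly
      (f.isBounded_evalPoly q) (M.law x hx) (show 0 < η / 4 by positivity)
    have h0 := (hpQ M x hx).1 fun q hq => by
      change ‖M.τ (M.evalPoly x q) - M.τ (M.evalPoly x q)‖ < δ
      simpa using hδ
    have h1 : Tendsto (fun k => C * (μ k).real (badSet M x (n k) Q δ)) atTop (𝓝 0) := by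
      have := (ENNReal.tendsto_toReal ENNReal.zero_ne_top).comp (h.tendsto_badSet Q hδ)
      simpa [Measure.real] using this.const_mul C
    obtain ⟨K₁, hK₁⟩ := (Metric.tendsto_atTop.mp h1) (η / 4) (by positivity)
    obtain ⟨K₂, hK₂⟩ := (Metric.tendsto_atTop.mp (h.external_averaging p)) (η / 4) (by positivity)
    refine ⟨max K₁ K₂, fun k hk => ?_⟩
    have h2 := hK₁ k (le_of_max_le_left hk)
    have h3 := hK₂ k (le_of_max_le_right hk)
    rw [Real.dist_eq, sub_zero] at h2
    have h2' := (le_abs_self _).trans_lt h2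
    have h4 : |‖M.condExp P (M.toL2 (M.evalPoly x p))‖ -
        ‖M.condExp P (M.toL2 (M.evalPoly (f.eval M x hx) q))‖| ≤ η / 4 := by
      refine (abs_norm_sub_norm_le _ _).trans ?_
      rw [← map_sub]
      refine (M.norm_condExp_le P _).trans ?_
      rwa [norm_sub_rev]
    have hint : ∀ (g : MatTuple I (n k) → (matrixAlgebra.{u} (n k)).Elem),
        AEStronglyMeasurable g (μ k) → (∃ D : ℝ, ∀ A ∈ MatTuple.box R, ‖g A‖ ≤ D) →
        Integrable g (μ k) := by
      rintro g hg ⟨D, hD⟩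
      exact Integrable.of_bound hg D ((hbox k).mono hD)
    -- Properness makes the target second countable, so continuous maps are strongly measurable even
    -- on an uncountable product.
    have hproper : ProperSpace (matrixAlgebra.{u} (n k)).Elem := FiniteDimensional.proper ℂ _
    have hcont : Continuous fun B : MatTuple I' (n k) => (matrixAlgebra.{u} (n k)).evalPoly B q :=
      MatTuple.continuous_evalPoly q
    have hi1 : Integrable (fun A => (matrixAlgebra.{u} (n k)).evalPoly
        (MatTuple.apply f A) q) (μ k) := by
      refine hint _ ?_ ?_
      · exact (hcont.aestronglyMeasurable (μ := (μ k).map (MatTuple.apply f))).comp_measurable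
          (hm k)
      · obtain ⟨D, -, hD⟩ := f.isBounded_evalPoly q
        exact ⟨D, fun A hA => by rw [MatTuple.apply_of_mem f hA]; exact hD _ A hA⟩
    have hi2 : Integrable (fun A => (matrixAlgebra.{u} (n k)).evalPoly A p) (μ k) := by
      refine hint _ (MatTuple.continuous_evalPoly p).aestronglyMeasurable ?_
      obtain ⟨D, -, hD⟩ := TracialWStarAlgebra.exists_norm_evalPoly_le R p
      exact ⟨D, fun A hA => hD _ A hA⟩
    have h5 : |(matrixAlgebra.{u} (n k)).norm2 (∫ B, (matrixAlgebra.{u} (n k)).evalPoly B q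
        ∂(MatTuple.pushforward f (μ k))) - (matrixAlgebra.{u} (n k)).norm2
        (∫ A, (matrixAlgebra.{u} (n k)).evalPoly A p ∂(μ k))| ≤
        η / 4 + C * (μ k).real (badSet M x (n k) Q δ) := by
      rw [MatTuple.pushforward, integral_map (hm k).aemeasurable hcont.aestronglyMeasurable,
        ← TracialWStarAlgebra.norm_toL2, ← TracialWStarAlgebra.norm_toL2]
      refine (abs_norm_sub_norm_le _ _).trans ?_
      -- The integral is moved into `L²`, where the integrand is small, before its norm is
      -- estimated.
      rw [← TracialWStarAlgebra.toL2CLM_apply, ← TracialWStarAlgebra.toL2CLM_apply,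
        ← map_sub, ← integral_sub hi1 hi2]
      refine (congrArg norm ((matrixAlgebra.{u} (n k)).toL2CLM.integral_comp_comm
        (hi1.sub hi2)).symm).trans_le ?_
      refine norm_integral_le_add_of_bad_set (μ k) _ (by positivity) _
        (measurableSet_badSet (M := M) (x := x) Q δ) ?_
      filter_upwards [hbox k] with A hA
      have e : (matrixAlgebra.{u} (n k)).toL2 ((matrixAlgebra.{u} (n k)).evalPoly
          (MatTuple.apply f A) q - (matrixAlgebra.{u} (n k)).evalPoly A p) =
          (matrixAlgebra.{u} (n k)).toL2 ((matrixAlgebra.{u} (n k)).evalPoly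
            (f.eval (matrixAlgebra (n k)) A hA) q) -
          (matrixAlgebra.{u} (n k)).toL2 ((matrixAlgebra.{u} (n k)).evalPoly A p) := by
        rw [map_sub, MatTuple.apply_of_mem f hA]
      exact ⟨fun hbad => (congrArg norm e).trans_le
        ((hpQ _ A hA).1 fun q hq => lt_of_notMem_badSet hbad hq),
        (congrArg norm e).trans_le (hpQ _ A hA).2⟩
    rw [Real.dist_eq] at h3 ⊢
    rw [abs_lt] at h3 ⊢
    rw [abs_le] at h4 h5
    constructor <;> linarith [h3.1, h3.2, h4.1, h4.2, h5.1, h5.2]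

end IsRandomMatrixModel

/-! ### Amplification and `2`-norm density of polynomials in generators. -/

section Amplification

variable {H : Type u} [NormedAddCommGroup H]

/-- The Hilbert space `ℓ²(ℕ, H)`. -/
abbrev SeqSpace (H : Type u) [NormedAddCommGroup H] : Type u := lp (fun _ : ℕ => H) 2

namespace SeqSpace

lemma hasSum_norm_sq (v : SeqSpace H) : HasSum (fun m => ‖v m‖ ^ 2) (‖v‖ ^ 2) := by
  have := lp.hasSum_norm (p := 2) (by simp) v
  simpa using this

lemma memℓp_of_summable {v : ℕ → H} (h : Summable fun m => ‖v m‖ ^ 2) : Memℓp v 2 :=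
  memℓp_gen (by simpa using h)

variable [InnerProductSpace ℂ H]

/-- The diagonal operator `T ⊕ T ⊕ ⋯` on `ℓ²(ℕ, H)`. -/
def amplify (T : H →L[ℂ] H) : SeqSpace H →L[ℂ] SeqSpace H :=
  LinearMap.mkContinuous
    { toFun := fun v => ⟨fun m => T (v m), memℓp_of_summable (.of_nonneg_of_le
        (fun _ => by positivity) (fun m => by
          rw [← mul_pow]
          gcongr
          exact T.le_opNorm _) ((hasSum_norm_sq v).summable.mul_left (‖T‖ ^ 2)))⟩
      map_add' := fun v w => by ext m; exact map_add T (v m) (w m)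
      map_smul' := fun c v => by ext m; simp } ‖T‖ fun v => by
    refine le_of_sq_le_sq ?_ (by positivity)
    rw [mul_pow]
    refine hasSum_le (fun m => ?_) (hasSum_norm_sq _) ((hasSum_norm_sq v).mul_left (‖T‖ ^ 2))
    rw [← mul_pow]
    gcongr
    exact T.le_opNorm _

@[simp] lemma amplify_apply (T : H →L[ℂ] H) (v : SeqSpace H) (m : ℕ) :
    amplify T v m = T (v m) := rfl

lemma inner_amplify [CompleteSpace H] {T : H →L[ℂ] H} (hT : IsSelfAdjoint T) (v w : SeqSpace H) :
    ⟪amplify T v, w⟫_ℂ = ⟪v, amplify T w⟫_ℂ := by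
  rw [lp.inner_eq_tsum, lp.inner_eq_tsum]
  exact tsum_congr fun m => ContinuousLinearMap.isSelfAdjoint_iff_isSymmetric.mp hT _ _

/-- The projection onto a subspace that is invariant under a set `S` of diagonal self-adjoint
operators commutes with all diagonal operators in the bicommutant of `S`. -/
lemma starProjection_amplify [CompleteSpace H] (K : Submodule ℂ (SeqSpace H))
    [K.HasOrthogonalProjection] {S : Set (H →L[ℂ] H)} (hS : ∀ T ∈ S, IsSelfAdjoint T)
    (hK : ∀ T ∈ S, ∀ v ∈ K, amplify T v ∈ K) {T : H →L[ℂ] H}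
    (hT : T ∈ Set.centralizer (Set.centralizer S)) (v : SeqSpace H) :
    K.starProjection (amplify T v) = amplify T (K.starProjection v) := by
  -- For self-adjoint `T` the invariant subspace is reducing.
  have h1 : ∀ T ∈ S, ∀ v, K.starProjection (amplify T v) = amplify T (K.starProjection v) := by
    intro T hT v
    refine Submodule.eq_starProjection_of_mem_of_inner_eq_zero
      (hK T hT _ (Submodule.starProjection_apply_mem K v)) fun w hw => ?_
    rw [← map_sub, inner_amplify (hS T hT)]
    exact Submodule.inner_left_of_mem_orthogonal (hK T hT w hw)
      (Submodule.sub_starProjection_mem_orthogonal v)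
  -- These are the matrix entries of the projection. They commute with `S`, hence with its
  -- bicommutant, and the projection is recovered from them by a convergent sum.
  let X : ℕ → ℕ → H →L[ℂ] H := fun m j =>
    (lp.evalCLM ℂ (fun _ : ℕ => H) 2 m).comp
      (K.starProjection.comp (lp.singleContinuousLinearMap ℂ (fun _ : ℕ => H) 2 j))
  have hX : ∀ m j (u : H), X m j u = K.starProjection (lp.single 2 j u) m := fun _ _ _ => rfl
  have hsingle : ∀ (T : H →L[ℂ] H) (j : ℕ) (u : H),
      amplify T (lp.single 2 j u) = lp.single 2 j (T u) := by
    intro T j u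
    ext m
    rw [amplify_apply, lp.single_apply, lp.single_apply]
    by_cases h : m = j
    · subst h; simp
    · simp [h]
  have hcomm : ∀ m j, X m j ∈ Set.centralizer S := by
    intro m j T hT
    ext u
    change T (X m j u) = X m j (T u)
    rw [hX, hX, ← hsingle, h1 T hT]
    rfl
  have hcomm' : ∀ m j (u : H), X m j (T u) = T (X m j u) := by
    intro m j u
    exact DFunLike.congr_fun (hT (X m j) (hcomm m j)) u
  have hsum : ∀ (m : ℕ) (w : SeqSpace H),
      HasSum (fun j => X m j (w j)) (K.starProjection w m) := fun m w =>
    (((lp.evalCLM ℂ (fun _ : ℕ => H) 2 m).comp K.starProjection).hasSum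
      (lp.hasSum_single (p := 2) (by simp) w))
  ext m
  refine (hsum m (amplify T v)).unique ?_
  have h2 := T.hasSum (hsum m v)
  simp only [amplify_apply, hcomm']
  exact h2

end SeqSpace

end Amplification

namespace TracialWStarAlgebra

variable (M : TracialWStarAlgebra.{u})

/-- Polynomials in a generating tuple are `2`-norm dense. -/
lemma exists_evalPoly_norm_sub_lt {I : Type u} (x : I → selfAdjoint M.Elem)
    (hx : M.wStar x = M.alg) (a : M.Elem) {ε : ℝ} (hε : 0 < ε) :
    ∃ p : NCPoly I, ‖M.toL2 a - M.toL2 (M.evalPoly x p)‖ < ε := by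
  obtain ⟨ξ, -, hξ⟩ := M.normal
  have hsum := M.hasSum_norm_sq hξ
  -- The trace vectors realize `L²(M)` inside `ℓ²(ℕ, H)`: `b ↦ (b ξₘ)ₘ` is isometric for the
  -- `2`-norm and turns left multiplication into amplification.
  let V : M.Elem →ₗ[ℂ] SeqSpace M.H :=
    { toFun := fun b => ⟨fun m => (b : M.H →L[ℂ] M.H) (ξ m),
        SeqSpace.memℓp_of_summable (hsum b).summable⟩
      map_add' := fun b c => by ext m; rfl
      map_smul' := fun c b => by ext m; simp }
  have hV : ∀ b, ‖V b‖ = ‖M.toL2 b‖ := fun b =>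
    (sq_eq_sq₀ (norm_nonneg _) (norm_nonneg _)).mp
      ((SeqSpace.hasSum_norm_sq (V b)).unique (hsum b))
  have hVmul : ∀ b c : M.Elem, V (b * c) = SeqSpace.amplify (b : M.H →L[ℂ] M.H) (V c) :=
    fun b c => rfl
  let K := (LinearMap.range (V ∘ₗ (M.evalPoly x).toLinearMap)).topologicalClosure
  have : CompleteSpace K := (Submodule.isClosed_topologicalClosure _).completeSpace_coe
  let S : Set (M.H →L[ℂ] M.H) := Set.range fun i => ((x i : M.Elem) : M.H →L[ℂ] M.H)
  have hS : ∀ T ∈ S, IsSelfAdjoint T := by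
    rintro _ ⟨i, rfl⟩
    exact congrArg Subtype.val (x i).2
  have hK : ∀ T ∈ S, ∀ v ∈ K, SeqSpace.amplify T v ∈ K := by
    rintro _ ⟨i, rfl⟩ v hv
    refine map_mem_closure (SeqSpace.amplify _).continuous hv ?_
    rintro _ ⟨p, rfl⟩
    refine ⟨FreeAlgebra.ι ℂ i * p, ?_⟩
    change V (M.evalPoly x (FreeAlgebra.ι ℂ i * p)) = _
    rw [map_mul, evalPoly_ι, hVmul]
    rfl
  have ha : (a : M.H →L[ℂ] M.H) ∈ Set.centralizer (Set.centralizer S) := by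
    have h1 : (a : M.H →L[ℂ] M.H) ∈ M.wStar x := by rw [hx]; exact a.2
    change (a : M.H →L[ℂ] M.H) ∈ (StarSubalgebra.centralizer ℂ
      (StarSubalgebra.centralizer ℂ S : Set (M.H →L[ℂ] M.H)) : Set (M.H →L[ℂ] M.H)) at h1
    rw [StarSubalgebra.coe_centralizer_centralizer] at h1
    have h2 : star S ⊆ S := fun T hT => by
      have := hS _ hT
      rw [IsSelfAdjoint, star_star] at this
      rw [this]; exact hT
    rwa [Set.union_eq_self_of_subset_right h2] at h1
  have h1 : V 1 ∈ K := Submodule.le_topologicalClosure _ ⟨1, by simp⟩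
  -- The von Neumann density argument: `V a` is the amplification of `a` applied to `V 1 ∈ K`, and
  -- that amplification commutes with the projection onto `K`.
  have h2 : V a ∈ K := by
    rw [← Submodule.starProjection_eq_self_iff, ← mul_one a, hVmul,
      SeqSpace.starProjection_amplify K hS hK ha, Submodule.starProjection_eq_self_iff.mpr h1]
  obtain ⟨_, ⟨p, rfl⟩, hp⟩ := Metric.mem_closure_iff.mp h2 ε hε
  refine ⟨p, ?_⟩
  rw [dist_eq_norm] at hp
  rw [← map_sub, ← hV, map_sub]
  exact hp

/-! ### Completeness of operator norm balls in the `2`-norm. -/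

/-- The trace vectors are separating for `M`: an element that kills all of them has `2`-norm `0`,
and `τ` is faithful. -/
lemma star_projection_eq_one_of_apply_eq {ξ : ℕ → M.H}
    (hξ : ∀ a : M.Elem, HasSum (fun m => ⟪ξ m, (a : M.H →L[ℂ] M.H) (ξ m)⟫_ℂ) (M.τ a))
    (e : M.Elem) (he : ∀ m, (e : M.H →L[ℂ] M.H) (ξ m) = ξ m) : e = 1 := by
  have h1 := M.hasSum_norm_sq hξ (e - 1)
  have h2 : (fun m => ‖((e - 1 : M.Elem) : M.H →L[ℂ] M.H) (ξ m)‖ ^ 2) = fun _ => 0 := by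
    funext m
    simp [he]
  rw [h2] at h1
  have h3 : M.toL2 (e - 1) = 0 := by simpa using h1.unique hasSum_zero
  rw [map_eq_zero_iff _ M.toL2_injective, sub_eq_zero] at h3
  exact h3

/-- Strong convergence implies convergence in the `2`-norm for `2`-norm Cauchy sequences. -/
lemma tendsto_toL2_of_tendsto_apply (a : ℕ → M.Elem) (b : M.Elem)
    (hb : ∀ h, Tendsto (fun k => (a k : M.H →L[ℂ] M.H) h) atTop (𝓝 ((b : M.H →L[ℂ] M.H) h)))
    (hc : CauchySeq fun k => M.toL2 (a k)) :
    Tendsto (fun k => M.toL2 (a k)) atTop (𝓝 (M.toL2 b)) := by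
  obtain ⟨ξ, -, hξ⟩ := M.normal
  have hsum := M.hasSum_norm_sq hξ
  rw [Metric.tendsto_atTop]
  intro ε hε
  obtain ⟨K, hK⟩ := Metric.cauchySeq_iff.mp hc (ε / 2) (by positivity)
  refine ⟨K, fun k hk => ?_⟩
  have key : ‖M.toL2 (a k - b)‖ ^ 2 ≤ (ε / 2) ^ 2 := by
    -- A Fatou argument: the bound for `a k - a l` passes to `l → ∞` on each finite partial sum.
    refine hasSum_le_of_sum_le (hsum (a k - b)) fun s => ?_
    have h1 : Tendsto (fun l => ∑ m ∈ s, ‖((a k - a l : M.Elem) : M.H →L[ℂ] M.H) (ξ m)‖ ^ 2)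
        atTop (𝓝 (∑ m ∈ s, ‖((a k - b : M.Elem) : M.H →L[ℂ] M.H) (ξ m)‖ ^ 2)) := by
      refine tendsto_finsetSum s fun m _ => ?_
      have h2 : Tendsto (fun l => (a k : M.H →L[ℂ] M.H) (ξ m) - (a l : M.H →L[ℂ] M.H) (ξ m)) atTop
          (𝓝 ((a k : M.H →L[ℂ] M.H) (ξ m) - (b : M.H →L[ℂ] M.H) (ξ m))) :=
        tendsto_const_nhds.sub (hb (ξ m))
      exact h2.norm.pow 2
    refine le_of_tendsto h1 ?_
    filter_upwards [eventually_ge_atTop K] with l hl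
    refine (sum_le_hasSum s (fun _ _ => by positivity) (hsum (a k - a l))).trans ?_
    have h2 := hK k hk l hl
    rw [dist_eq_norm, ← map_sub] at h2
    gcongr
  rw [dist_eq_norm, ← map_sub]
  have := le_of_sq_le_sq key (by positivity)
  linarith

/-- The self-adjoint part of an operator norm ball of `M` is complete in the `2`-norm. -/
lemma exists_tendsto_toL2 (a : ℕ → M.Elem) (hsa : ∀ k, IsSelfAdjoint (a k)) {r : ℝ}
    (hr : ∀ k, ‖a k‖ ≤ r) (hc : CauchySeq fun k => M.toL2 (a k)) :
    ∃ b : M.Elem, IsSelfAdjoint b ∧ ‖b‖ ≤ r ∧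
      Tendsto (fun k => M.toL2 (a k)) atTop (𝓝 (M.toL2 b)) := by
  obtain ⟨ξ, -, hξ⟩ := M.normal
  have hsum := M.hasSum_norm_sq hξ
  have hr0 : 0 ≤ r := (norm_nonneg _).trans (hr 0)
  have hbound : ∀ k (h : M.H), ‖(a k : M.H →L[ℂ] M.H) h‖ ≤ r * ‖h‖ := fun k h =>
    ((a k : M.H →L[ℂ] M.H).le_opNorm h).trans (mul_le_mul_of_nonneg_right (hr k) (norm_nonneg _))
  have hlin : ∀ (l : M.H →L[ℂ] M.H) {s : ℕ → M.H}, CauchySeq s → CauchySeq fun k => l (s k) :=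
    fun l s hs => l.uniformContinuous.comp_cauchySeq hs
  -- The vectors on which the sequence converges strongly. The uniform bound `r` makes this subspace
  -- closed.
  let D : Submodule ℂ M.H :=
    { carrier := {h | CauchySeq fun k => (a k : M.H →L[ℂ] M.H) h}
      zero_mem' := by simpa using cauchySeq_const (0 : M.H)
      add_mem' := fun {g h} hg hh => by
        change CauchySeq fun k => (a k : M.H →L[ℂ] M.H) (g + h)
        simp only [map_add]
        exact CauchySeq.add hg hh
      smul_mem' := fun c h hh => by
        change CauchySeq fun k => (a k : M.H →L[ℂ] M.H) (c • h)
        simp only [map_smul]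
        exact hlin (c • ContinuousLinearMap.id ℂ M.H) hh }
  have hDcl : IsClosed (D : Set M.H) := by
    refine isClosed_of_closure_subset fun h hh => ?_
    change CauchySeq fun k => (a k : M.H →L[ℂ] M.H) h
    rw [Metric.cauchySeq_iff']
    intro ε hε
    obtain ⟨g, hg, hgh⟩ := Metric.mem_closure_iff.mp hh (ε / (4 * (r + 1))) (by positivity)
    obtain ⟨K, hK⟩ := Metric.cauchySeq_iff'.mp (show CauchySeq _ from hg) (ε / 2) (by positivity)
    refine ⟨K, fun k hk => ?_⟩
    have h1 := hK k hk
    have h2 : ∀ k, dist ((a k : M.H →L[ℂ] M.H) h) ((a k : M.H →L[ℂ] M.H) g) ≤ ε / 4 := by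
      intro k
      rw [dist_eq_norm, ← map_sub]
      rw [dist_eq_norm] at hgh
      refine (hbound k _).trans ((mul_le_mul_of_nonneg_left hgh.le hr0).trans ?_)
      rw [mul_div_assoc', div_le_div_iff₀ (by positivity) (by positivity)]
      nlinarith
    have h3 := dist_triangle4 ((a k : M.H →L[ℂ] M.H) h) ((a k : M.H →L[ℂ] M.H) g)
      ((a K : M.H →L[ℂ] M.H) g) ((a K : M.H →L[ℂ] M.H) h)
    have h4 := h2 K
    rw [dist_comm] at h4
    linarith [h2 k]
  have hcomplete : CompleteSpace D := hDcl.completeSpace_coe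
  have hcommut : ∀ t ∈ M.alg.commutant, ∀ k (h : M.H),
      (a k : M.H →L[ℂ] M.H) (t h) = t ((a k : M.H →L[ℂ] M.H) h) := fun t ht k h =>
    DFunLike.congr_fun (VonNeumannAlgebra.mem_commutant_iff.mp ht _ (a k).2) h
  -- `D` is invariant under the commutant, so its projection lies in `M`; it contains every trace
  -- vector, on which `2`-norm convergence dominates. The projection is therefore `1`.
  have hD : D = ⊤ := by
    have he : D.starProjection ∈ M.alg := by
      rw [VonNeumannAlgebra.IsStarProjection.mem_iff isStarProjection_starProjection]
      intro t ht
      rw [Submodule.range_starProjection, Module.End.mem_invtSubmodule]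
      intro h hh
      change CauchySeq fun k => (a k : M.H →L[ℂ] M.H) (t h)
      simp only [hcommut t ht]
      exact hlin t hh
    have hξD : ∀ m, ξ m ∈ D := by
      intro m
      refine Metric.cauchySeq_iff.mpr fun ε hε => ?_
      obtain ⟨K, hK⟩ := Metric.cauchySeq_iff.mp hc ε hε
      refine ⟨K, fun k hk l hl => lt_of_le_of_lt ?_ (hK k hk l hl)⟩
      rw [dist_eq_norm, dist_eq_norm, ← map_sub]
      refine le_of_sq_le_sq ?_ (norm_nonneg _)
      exact le_hasSum (hsum (a k - a l)) m fun _ _ => by positivity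
    have h1 := M.star_projection_eq_one_of_apply_eq hξ ⟨D.starProjection, he⟩ fun m =>
      Submodule.starProjection_eq_self_iff.mpr (hξD m)
    rw [eq_top_iff]
    intro h _
    rw [← Submodule.starProjection_eq_self_iff]
    exact DFunLike.congr_fun (congrArg Subtype.val h1) h
  have hlim : ∀ h : M.H, ∃ g, Tendsto (fun k => (a k : M.H →L[ℂ] M.H) h) atTop (𝓝 g) := fun h =>
    cauchySeq_tendsto_of_complete (show h ∈ D by rw [hD]; trivial)
  choose L hL using hlim
  let b : M.H →L[ℂ] M.H :=
    continuousLinearMapOfTendsto (fun k => (a k : M.H →L[ℂ] M.H)) (tendsto_pi_nhds.mpr hL)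
  have hb : ∀ h, Tendsto (fun k => (a k : M.H →L[ℂ] M.H) h) atTop (𝓝 (b h)) := hL
  have hbM : b ∈ M.alg := by
    rw [← M.alg.commutant_commutant, VonNeumannAlgebra.mem_commutant_iff]
    intro t ht
    ext h
    refine tendsto_nhds_unique ((t.continuous.tendsto _).comp (hb h)) ?_
    refine (hb (t h)).congr fun k => ?_
    exact hcommut t ht k h
  have hbsa : IsSelfAdjoint b := by
    rw [ContinuousLinearMap.isSelfAdjoint_iff_isSymmetric]
    intro g h
    refine tendsto_nhds_unique (((hb g).inner (tendsto_const_nhds (x := h)))) ?_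
    refine ((tendsto_const_nhds (x := g)).inner (hb h)).congr fun k => ?_
    have hk : IsSelfAdjoint (a k : M.H →L[ℂ] M.H) := congrArg Subtype.val (hsa k)
    exact (ContinuousLinearMap.isSelfAdjoint_iff_isSymmetric.mp hk g h).symm
  refine ⟨⟨b, hbM⟩, Subtype.ext hbsa, ?_, ?_⟩
  · exact ContinuousLinearMap.opNorm_le_bound _ hr0 fun h =>
      le_of_tendsto (hb h).norm (.of_forall fun k => hbound k h)
  · exact M.tendsto_toL2_of_tendsto_apply a ⟨b, hbM⟩ hb hc

end TracialWStarAlgebra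

/-! ### Functional calculus of `squash`. -/

/-- The function `t ↦ 2t / (1 + t²)`, which maps `ℝ` and `[-1, 1]` onto `[-1, 1]`. -/
def squash (t : ℝ) : ℝ := 2 * t / (1 + t ^ 2)

lemma continuous_squash : Continuous squash :=
  Continuous.div (by fun_prop) (by fun_prop) fun t => by positivity

lemma abs_squash_le (t : ℝ) : |squash t| ≤ 1 := by
  rw [squash, abs_div, abs_of_pos (show (0 : ℝ) < 1 + t ^ 2 by positivity),
    div_le_one (by positivity), abs_le]
  constructor <;> nlinarith [sq_nonneg (t - 1), sq_nonneg (t + 1)]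

/-- With `s = sin θ` and `cos θ ≥ 0` the argument is `tan (θ/2)`, and this is the half-angle formula
for the sine. -/
lemma squash_div_one_add_sqrt {s : ℝ} (hs : |s| ≤ 1) :
    squash (s / (1 + Real.sqrt (1 - s ^ 2))) = s := by
  have h1 : s ^ 2 ≤ 1 := by rw [← sq_abs]; exact pow_le_one₀ (abs_nonneg _) hs
  have h2 := Real.sq_sqrt (show 0 ≤ 1 - s ^ 2 by linarith)
  have h3 := Real.sqrt_nonneg (1 - s ^ 2)
  set c := Real.sqrt (1 - s ^ 2)
  have h4 : 1 + c ≠ 0 := by positivity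
  have h5 : (1 + c) ^ 2 + s ^ 2 = 2 * (1 + c) := by linear_combination h2
  rw [squash, div_pow]
  rw [show 1 + s ^ 2 / (1 + c) ^ 2 = ((1 + c) ^ 2 + s ^ 2) / (1 + c) ^ 2 by field_simp, h5]
  field_simp

namespace TracialWStarAlgebra

variable (M : TracialWStarAlgebra.{u})

instance : CStarAlgebra M.Elem :=
  StarSubalgebra.cstarAlgebra (S := StarSubalgebra ℂ (M.H →L[ℂ] M.H)) M.alg.toStarSubalgebra
    (h_closed := by
      change IsClosed (M.alg : Set (M.H →L[ℂ] M.H))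
      rw [← M.alg.centralizer_centralizer]
      exact Set.isClosed_centralizer _)

lemma abs_le_of_mem_spectrum {a : M.Elem} {t : ℝ} (ht : t ∈ spectrum ℝ a) : |t| ≤ ‖a‖ := by
  have h := spectrum.subset_closedBall_norm_mul (𝕜 := ℝ) a ht
  rw [mem_closedBall_zero_iff, Real.norm_eq_abs] at h
  exact h.trans (mul_le_of_le_one_right (norm_nonneg _) ContinuousLinearMap.norm_id_le)

lemma norm_cfc_squash_le (a : M.Elem) : ‖cfc squash a‖ ≤ 1 :=
  norm_cfc_le zero_le_one fun t _ => abs_squash_le t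

lemma exists_cfc_squash_eq {a : M.Elem} (ha : IsSelfAdjoint a) (ha1 : ‖a‖ ≤ 1) :
    ∃ b : M.Elem, IsSelfAdjoint b ∧ cfc squash b = a := by
  -- Continuity on the whole line uses that `Real.sqrt` is `0` on negative numbers; only `[-1, 1]`
  -- matters for the spectrum.
  have hc : Continuous fun s : ℝ => s / (1 + Real.sqrt (1 - s ^ 2)) :=
    Continuous.div (by fun_prop) (by fun_prop) fun s => by positivity
  refine ⟨cfc (fun s : ℝ => s / (1 + Real.sqrt (1 - s ^ 2))) a, cfc_predicate _ _, ?_⟩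
  rw [← cfc_comp' squash _ a continuous_squash.continuousOn hc.continuousOn]
  conv_rhs => rw [← cfc_id ℝ a]
  exact cfc_congr fun s hs =>
    squash_div_one_add_sqrt ((M.abs_le_of_mem_spectrum hs).trans ha1)

/-- Here `A = (1 + a²)⁻¹`. Since `squash` is rational, these relations reduce its Lipschitz estimate
to algebra. -/
lemma exists_resolvent {a : M.Elem} (ha : IsSelfAdjoint a) :
    ∃ A : M.Elem, ‖A‖ ≤ 1 ∧ ‖a * A‖ ≤ 1 ∧ A * a = a * A ∧ A * (1 + a * a) = 1 ∧
      (1 + a * a) * A = 1 ∧ cfc squash a = (2 : ℝ) • (a * A) := by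
  have hc : Continuous fun t : ℝ => (1 + t ^ 2)⁻¹ :=
    Continuous.inv₀ (by fun_prop) fun t => by positivity
  have h1 : a * cfc (fun t : ℝ => (1 + t ^ 2)⁻¹) a = cfc (fun t : ℝ => t * (1 + t ^ 2)⁻¹) a := by
    conv_lhs => enter [1]; rw [← cfc_id' ℝ a]
    rw [← cfc_mul (fun t : ℝ => t) _ a continuous_id.continuousOn hc.continuousOn]
  have h1' : cfc (fun t : ℝ => (1 + t ^ 2)⁻¹) a * a = cfc (fun t : ℝ => (1 + t ^ 2)⁻¹ * t) a := by
    conv_lhs => enter [2]; rw [← cfc_id' ℝ a]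
    rw [← cfc_mul _ (fun t : ℝ => t) a hc.continuousOn continuous_id.continuousOn]
  have h2 : 1 + a * a = cfc (fun t : ℝ => 1 + t ^ 2) a := by
    rw [cfc_const_add (1 : ℝ) _ a (by fun_prop), cfc_pow_id (R := ℝ) a 2, sq, map_one]
  refine ⟨cfc (fun t : ℝ => (1 + t ^ 2)⁻¹) a, ?_, ?_, ?_, ?_, ?_, ?_⟩
  · refine norm_cfc_le zero_le_one fun t _ => ?_
    rw [Real.norm_eq_abs, abs_of_nonneg (by positivity)]
    exact inv_le_one_of_one_le₀ (by nlinarith [sq_nonneg t])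
  · rw [h1]
    refine norm_cfc_le zero_le_one fun t _ => ?_
    rw [Real.norm_eq_abs, ← div_eq_mul_inv, abs_div,
      abs_of_pos (show (0 : ℝ) < 1 + t ^ 2 by positivity), div_le_one (by positivity), abs_le]
    constructor <;> nlinarith [sq_nonneg (t - 1), sq_nonneg (t + 1)]
  · rw [h1, h1']
    simp only [mul_comm]
  · rw [h2, ← cfc_mul _ _ a hc.continuousOn (by fun_prop), ← cfc_one ℝ a]
    exact cfc_congr fun t _ => inv_mul_cancel₀ (by positivity)
  · rw [h2, ← cfc_mul _ _ a (by fun_prop) hc.continuousOn, ← cfc_one ℝ a]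
    exact cfc_congr fun t _ => mul_inv_cancel₀ (by positivity)
  · rw [h1, ← cfc_smul (2 : ℝ) (fun t : ℝ => t * (1 + t ^ 2)⁻¹) a
      (continuous_id.mul hc).continuousOn]
    exact cfc_congr fun t _ => by simp only [squash, smul_eq_mul]; ring

/-- The functional calculus of `squash` is Lipschitz for the `2`-norm. -/
lemma norm_toL2_cfc_squash_sub_le {a b : M.Elem} (ha : IsSelfAdjoint a) (hb : IsSelfAdjoint b) :
    ‖M.toL2 (cfc squash a) - M.toL2 (cfc squash b)‖ ≤ 4 * ‖M.toL2 a - M.toL2 b‖ := by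
  obtain ⟨A, hA, haA, hAa, hA1, -, hcA⟩ := M.exists_resolvent ha
  obtain ⟨B, hB, hbB, -, -, hB1, hcB⟩ := M.exists_resolvent hb
  -- A resolvent identity in which `a - b` stands between contractions. Each of the two terms
  -- contributes once, and the factor `2` in `squash` doubles the sum, whence the constant `4`.
  have h1 : a * A - b * B = A * (a - b) * B - (a * A) * (a - b) * (b * B) := by
    have e1 : a * A = A * a * ((1 + b * b) * B) := by rw [hB1, mul_one, hAa]
    have e2 : b * B = A * (1 + a * a) * (b * B) := by rw [hA1, one_mul]
    calc a * A - b * B = A * a * ((1 + b * b) * B) - A * (1 + a * a) * (b * B) := by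
          rw [← e1, ← e2]
      _ = A * (a - b) * B - (A * a) * (a - b) * (b * B) := by noncomm_ring
      _ = _ := by rw [hAa]
  have hs : ∀ u v : M.Elem, ‖u‖ ≤ 1 → ‖v‖ ≤ 1 →
      ‖M.toL2 (u * (a - b) * v)‖ ≤ ‖M.toL2 (a - b)‖ := by
    intro u v hu hv
    refine (M.norm_toL2_mul_le_right _ _).trans
      ((mul_le_of_le_one_right (norm_nonneg _) hv).trans ?_)
    exact (M.norm_toL2_mul_le_left _ _).trans (mul_le_of_le_one_left (norm_nonneg _) hu)
  rw [← map_sub, ← map_sub, hcA, hcB, ← smul_sub, h1, two_smul, map_add, map_sub]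
  have h2 := hs A B hA hB
  have h3 := hs (a * A) (b * B) haA hbB
  have h4 := norm_sub_le (M.toL2 (A * (a - b) * B)) (M.toL2 (a * A * (a - b) * (b * B)))
  refine (norm_add_le _ _).trans ?_
  linarith

end TracialWStarAlgebra

/-! ### Realizing elements of `W^*(x)` as values of functions. -/

namespace NCFun

variable {I : Type u} {R : I → ℝ}

/-- The spectra of all values of `g` lie in one interval `[-C, C]`. Weierstrass approximation there
replaces `squash` by a polynomial, and a polynomial in `g` is again in `A_R`. -/
lemma isApproximable_cfc_squash (g : C(NCLaw R, ℂ) ⊗[ℂ] NCPoly I)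
    (hg : ∀ (M : TracialWStarAlgebra.{u}) (x : I → selfAdjoint M.Elem)
      (hx : ∀ i, ‖(x i : M.Elem)‖ ≤ R i), IsSelfAdjoint (M.ev x hx g)) :
    IsApproximable (R := R) fun M x hx => cfc squash (M.ev x hx g) := by
  intro ε hε
  obtain ⟨C, -, hC⟩ := TracialWStarAlgebra.exists_norm_ev_le g
  obtain ⟨q, hq⟩ := exists_polynomial_near_of_continuousOn (-C) C squash
    continuous_squash.continuousOn ε hε
  refine ⟨Polynomial.aeval g (q.map (algebraMap ℝ ℂ)), fun M x hx => ?_⟩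
  rw [← M.evHom_apply, ← Polynomial.aeval_algHom_apply, M.evHom_apply,
    Polynomial.aeval_map_algebraMap, ← map_sub]
  refine (M.norm_toL2_le _).trans ?_
  rw [← cfc_polynomial q (M.ev x hx g) (hg M x hx),
    ← cfc_sub _ _ _ continuous_squash.continuousOn q.continuous.continuousOn]
  refine norm_cfc_le hε.le fun t ht => ?_
  rw [Real.norm_eq_abs, abs_sub_comm]
  exact (hq t (abs_le.mp ((M.abs_le_of_mem_spectrum ht).trans (hC M x hx)))).le

/-- A continuous function on `Σ_R` that is `1` where `λ(q^* q)` is small and keeps `φ q` small. -/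
lemma exists_cutoff (q : NCPoly I) {δ : ℝ} (hδ : 0 < δ) : ∃ φ : C(NCLaw R, ℂ),
    (∀ l, IsSelfAdjoint (φ l)) ∧
    ∀ (M : TracialWStarAlgebra.{u}) (x : I → selfAdjoint M.Elem)
      (hx : ∀ i, ‖(x i : M.Elem)‖ ≤ R i), ‖M.toL2 (φ (M.law x hx) • M.evalPoly x q)‖ ≤ δ ∧
        (‖M.toL2 (M.evalPoly x q)‖ ≤ δ → φ (M.law x hx) = 1) := by
  let N : NCLaw R → ℝ := fun l => Real.sqrt (l.1 (q.adj * q)).re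
  have hN : Continuous N :=
    Real.continuous_sqrt.comp (Complex.continuous_re.comp (NCLaw.continuous_eval _))
  have hmax : ∀ l, 0 < max δ (N l) := fun l => lt_max_of_lt_left hδ
  -- At the law of `x`, `N` is `‖q(x)‖₂`, so this factor shrinks `q(x)` to `2`-norm at most `δ` and
  -- is `1` when nothing needs shrinking.
  refine ⟨⟨fun l => ((δ / max δ (N l) : ℝ) : ℂ), Complex.continuous_ofReal.comp
    (continuous_const.div (continuous_const.max hN) fun l => (hmax l).ne')⟩,
    fun l => Complex.conj_ofReal _, fun M x hx => ?_⟩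
  have h1 : N (M.law x hx) = ‖M.toL2 (M.evalPoly x q)‖ := by
    rw [M.norm_toL2, TracialWStarAlgebra.norm2, ← M.evalPoly_adj, ← map_mul]
    rfl
  have h2 := hmax (M.law x hx)
  simp only [ContinuousMap.coe_mk, map_smul, norm_smul, ← h1]
  refine ⟨?_, fun h => ?_⟩
  · rw [Complex.norm_real, Real.norm_eq_abs, abs_of_pos (by positivity), div_mul_eq_mul_div,
      div_le_iff₀ h2]
    exact mul_le_mul_of_nonneg_left (le_max_right _ _) hδ.le
  · rw [max_eq_left h, div_self hδ.ne', Complex.ofReal_one]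

end NCFun

namespace TracialWStarAlgebra

variable (M : TracialWStarAlgebra.{u}) {I : Type u} {R : I → ℝ}

/-- Symmetrizing to `(p + p^*)/2` makes the values self-adjoint at every tuple and does not increase
the distance to the self-adjoint `b`. -/
lemma exists_selfAdjoint_evalPoly_norm_sub_lt (x : I → selfAdjoint M.Elem)
    (hx : M.wStar x = M.alg) {b : M.Elem} (hb : IsSelfAdjoint b) {ε : ℝ} (hε : 0 < ε) :
    ∃ p : NCPoly I, (∀ (N : TracialWStarAlgebra.{u}) (y : I → selfAdjoint N.Elem),
      IsSelfAdjoint (N.evalPoly y p)) ∧ ‖M.toL2 b - M.toL2 (M.evalPoly x p)‖ < ε := by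
  obtain ⟨p, hp⟩ := M.exists_evalPoly_norm_sub_lt x hx b hε
  have hev : ∀ (N : TracialWStarAlgebra.{u}) (y : I → selfAdjoint N.Elem),
      N.evalPoly y ((1 / 2 : ℂ) • (p + p.adj)) =
        (1 / 2 : ℂ) • (N.evalPoly y p + star (N.evalPoly y p)) := fun N y => by
    rw [map_smul, map_add, N.evalPoly_adj]
  refine ⟨(1 / 2 : ℂ) • (p + p.adj), fun N y => ?_, ?_⟩
  · rw [hev]
    refine IsSelfAdjoint.smul ?_ (IsSelfAdjoint.add_star_self _)
    simp [IsSelfAdjoint]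
  · have h1 : b - (1 / 2 : ℂ) • (M.evalPoly x p + star (M.evalPoly x p)) =
        (1 / 2 : ℂ) • ((b - M.evalPoly x p) + star (b - M.evalPoly x p)) := by
      rw [star_sub, hb.star_eq]
      module
    rw [hev, ← map_sub, h1, map_smul, norm_smul, map_add]
    rw [← map_sub] at hp
    have h2 := norm_add_le (M.toL2 (b - M.evalPoly x p)) (M.toL2 (star (b - M.evalPoly x p)))
    rw [norm_toL2_star] at h2
    have h3 : ‖(1 / 2 : ℂ)‖ = 1 / 2 := by norm_num
    rw [h3]
    linarith

/-- A sequence of polynomials in `x` that converges in the `2`-norm lifts to a `‖·‖_{R,2}`-Cauchy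
sequence in `A_R`. -/
lemma exists_lift_of_evalPoly (x : I → selfAdjoint M.Elem) (hxR : ∀ i, ‖(x i : M.Elem)‖ ≤ R i)
    (p : ℕ → NCPoly I)
    (hpsa : ∀ k (N : TracialWStarAlgebra.{u}) (y : I → selfAdjoint N.Elem),
      IsSelfAdjoint (N.evalPoly y (p k)))
    (hp : ∀ k, ‖M.toL2 (M.evalPoly x (p (k + 1) - p k))‖ ≤ (1 / 2) ^ k) :
    ∃ g : ℕ → C(NCLaw R, ℂ) ⊗[ℂ] NCPoly I,
      (∀ k (N : TracialWStarAlgebra.{u}) (y : I → selfAdjoint N.Elem)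
        (hy : ∀ i, ‖(y i : N.Elem)‖ ≤ R i), IsSelfAdjoint (N.ev y hy (g k))) ∧
      (∀ k (N : TracialWStarAlgebra.{u}) (y : I → selfAdjoint N.Elem)
        (hy : ∀ i, ‖(y i : N.Elem)‖ ≤ R i),
        ‖N.toL2 (N.ev y hy (g k)) - N.toL2 (N.ev y hy (g (k + 1)))‖ ≤ (1 / 2) ^ k) ∧
      ∀ k, M.ev x hxR (g k) = M.evalPoly x (p k) := by
  choose φ hφsa hφ using fun k : ℕ => NCFun.exists_cutoff (R := R) (p (k + 1) - p k)
    (show (0 : ℝ) < (1 / 2) ^ k by positivity)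
  -- The telescoping sum `p₀ + ∑ φⱼ (pⱼ₊₁ - pⱼ)` over `j < k`, with cutoff level `2⁻ʲ`. At `x` every
  -- cutoff is `1` by hypothesis, so the sum collapses to `pₖ`.
  let g : ℕ → C(NCLaw R, ℂ) ⊗[ℂ] NCPoly I := fun k =>
    Nat.rec (1 ⊗ₜ p 0) (fun k gk => gk + φ k ⊗ₜ (p (k + 1) - p k)) k
  have hg0 : g 0 = 1 ⊗ₜ p 0 := rfl
  have hgs : ∀ k, g (k + 1) = g k + φ k ⊗ₜ (p (k + 1) - p k) := fun _ => rfl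
  clear_value g
  refine ⟨g, fun k N y hy => ?_, fun k N y hy => ?_, fun k => ?_⟩
  · induction k with
    | zero => rw [hg0, ev_tmul]; simpa using hpsa 0 N y
    | succ k ih =>
      rw [hgs, map_add, ev_tmul, map_sub]
      exact ih.add (IsSelfAdjoint.smul (hφsa k _) ((hpsa (k + 1) N y).sub (hpsa k N y)))
  · rw [norm_sub_rev, ← map_sub, hgs, map_add, add_sub_cancel_left, ev_tmul]
    exact (hφ k N y hy).1
  · induction k with
    | zero => rw [hg0, ev_tmul]; simp
    | succ k ih =>
      rw [hgs, map_add, ev_tmul, ih, (hφ k M x hxR).2 (hp k), one_smul, ← map_add, add_sub_cancel]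

lemma norm_toL2_smul_squash_sub_le {a b : M.Elem} (ha : IsSelfAdjoint a) (hb : IsSelfAdjoint b)
    {r : ℝ} (hr : 0 ≤ r) :
    ‖M.toL2 ((r : ℂ) • cfc squash a) - M.toL2 ((r : ℂ) • cfc squash b)‖ ≤
      r * 4 * ‖M.toL2 a - M.toL2 b‖ := by
  rw [map_smul, map_smul, ← smul_sub, norm_smul, Complex.norm_real, Real.norm_eq_abs,
    abs_of_nonneg hr, mul_assoc]
  exact mul_le_mul_of_nonneg_left (M.norm_toL2_cfc_squash_sub_le ha hb) hr

lemma isSelfAdjoint_smul_squash (a : M.Elem) (r : ℝ) :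
    IsSelfAdjoint ((r : ℂ) • cfc squash a) :=
  IsSelfAdjoint.smul (Complex.conj_ofReal r) (cfc_predicate _ _)

lemma norm_smul_squash_le (a : M.Elem) {r : ℝ} (hr : 0 ≤ r) : ‖(r : ℂ) • cfc squash a‖ ≤ r := by
  refine (norm_smul_le _ _).trans ?_
  rw [Complex.norm_real, Real.norm_eq_abs, abs_of_nonneg hr]
  exact mul_le_of_le_one_right hr (M.norm_cfc_squash_le _)

end TracialWStarAlgebra

/-- The limit in `F_{R,∞}` of `r · squash(gₖ)` for a `‖·‖_{R,2}`-Cauchy sequence `gₖ`. -/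
lemma Fun2.exists_tendsto_squash {I : Type u} {R : I → ℝ}
    (g : ℕ → C(NCLaw R, ℂ) ⊗[ℂ] NCPoly I)
    (hgsa : ∀ k (N : TracialWStarAlgebra.{u}) (y : I → selfAdjoint N.Elem)
      (hy : ∀ i, ‖(y i : N.Elem)‖ ≤ R i), IsSelfAdjoint (N.ev y hy (g k)))
    (hg : ∀ k (N : TracialWStarAlgebra.{u}) (y : I → selfAdjoint N.Elem)
      (hy : ∀ i, ‖(y i : N.Elem)‖ ≤ R i),
      ‖N.toL2 (N.ev y hy (g k)) - N.toL2 (N.ev y hy (g (k + 1)))‖ ≤ (1 / 2) ^ k)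
    {r : ℝ} (hr : 0 < r) :
    ∃ f : Fun2 R, f.IsSelfAdjointBoundedBy r ∧ ∀ (N : TracialWStarAlgebra.{u})
      (y : I → selfAdjoint N.Elem) (hy : ∀ i, ‖(y i : N.Elem)‖ ≤ R i),
      Tendsto (fun k => N.toL2 ((r : ℂ) • cfc squash (N.ev y hy (g k)))) atTop
        (𝓝 (Fun2.eval N y hy f)) := by
  have hstep : ∀ (N : TracialWStarAlgebra.{u}) (y : I → selfAdjoint N.Elem)
      (hy : ∀ i, ‖(y i : N.Elem)‖ ≤ R i) (k : ℕ),
      dist (N.toL2 ((r : ℂ) • cfc squash (N.ev y hy (g k))))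
        (N.toL2 ((r : ℂ) • cfc squash (N.ev y hy (g (k + 1))))) ≤ (r * 4) * (1 / 2) ^ k := by
    intro N y hy k
    rw [dist_eq_norm]
    exact (N.norm_toL2_smul_squash_sub_le (hgsa _ N y hy) (hgsa _ N y hy) hr.le).trans
      (mul_le_mul_of_nonneg_left (hg k N y hy) (by positivity))
  have hlim : ∀ (N : TracialWStarAlgebra.{u}) (y : I → selfAdjoint N.Elem)
      (hy : ∀ i, ‖(y i : N.Elem)‖ ≤ R i), ∃ b : N.Elem, IsSelfAdjoint b ∧ ‖b‖ ≤ r ∧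
      Tendsto (fun k => N.toL2 ((r : ℂ) • cfc squash (N.ev y hy (g k)))) atTop
        (𝓝 (N.toL2 b)) := fun N y hy =>
    N.exists_tendsto_toL2 (fun k => (r : ℂ) • cfc squash (N.ev y hy (g k)))
      (fun k => N.isSelfAdjoint_smul_squash _ r) (fun k => N.norm_smul_squash_le _ hr.le)
      (cauchySeq_of_le_geometric (1 / 2) (r * 4) (by norm_num) (hstep N y hy))
  choose F hFsa hFr hF using hlim
  have happrox : NCFun.IsApproximable F := by
    refine .of_limit fun ε hε => ?_
    -- The tail of the geometric series with first term `4r · 2⁻ᵏ` is `8r · 2⁻ᵏ`, uniformly over all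
    -- tuples.
    obtain ⟨k, hk⟩ := exists_pow_lt_of_lt_one (show 0 < ε / (r * 8) by positivity)
      (show (1 / 2 : ℝ) < 1 by norm_num)
    refine ⟨fun N y hy => (r : ℂ) • cfc squash (N.ev y hy (g k)), ?_, fun N y hy => ?_⟩
    · have h1 := (NCFun.isApproximable_ev ((r : ℂ) • (1 : C(NCLaw R, ℂ) ⊗[ℂ] NCPoly I))).mul
        (NCFun.isApproximable_cfc_squash (g k) (hgsa k))
        ⟨1, zero_le_one, fun N y hy => N.norm_cfc_squash_le _⟩
      convert h1 using 4 with N y hy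
      rw [map_smul, N.ev_one, smul_one_mul]
    · have h1 := dist_le_of_le_geometric_of_tendsto (1 / 2) (r * 4) (by norm_num)
        (hstep N y hy) (hF N y hy) k
      rw [dist_eq_norm, norm_sub_rev] at h1
      refine h1.trans ?_
      rw [lt_div_iff₀ (by positivity)] at hk
      rw [show (1 : ℝ) - 1 / 2 = 1 / 2 by norm_num, div_le_iff₀ (by norm_num)]
      linarith
  obtain ⟨f, hf⟩ := Fun2.exists_eval_eq happrox
  refine ⟨f, fun N y hy => ⟨⟨F N y hy, hFsa N y hy⟩, (hf N y hy).symm, hFr N y hy⟩,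
    fun N y hy => ?_⟩
  rw [hf]
  exact hF N y hy

namespace TracialWStarAlgebra

variable (M : TracialWStarAlgebra.{u}) {I : Type u} {R : I → ℝ}

/-- Every self-adjoint element of `W^*(x)` is the value at `x` of a function in `F_{R,∞}` with the
same bound. -/
theorem exists_fun2_eval_eq (x : I → selfAdjoint M.Elem) (hx : M.wStar x = M.alg)
    (hxR : ∀ i, ‖(x i : M.Elem)‖ ≤ R i) (a : selfAdjoint M.Elem) {r : ℝ} (hr : 0 < r)
    (har : ‖(a : M.Elem)‖ ≤ r) :
    ∃ f : Fun2 R, f.IsSelfAdjointBoundedBy r ∧ Fun2.eval M x hxR f = M.toL2 a := by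
  have hrC : (r : ℂ) ≠ 0 := Complex.ofReal_ne_zero.mpr hr.ne'
  obtain ⟨b, hb, hba⟩ := M.exists_cfc_squash_eq (a := (r : ℂ)⁻¹ • (a : M.Elem))
    (IsSelfAdjoint.smul (by simp [IsSelfAdjoint]) a.2) (by
      refine (norm_smul_le _ _).trans ?_
      rw [norm_inv, Complex.norm_real, Real.norm_eq_abs, abs_of_pos hr, inv_mul_le_iff₀ hr, mul_one]
      exact har)
  -- Accuracy `2⁻ᵏ/2` makes consecutive polynomials differ by at most `(1/2 + 1/4) 2⁻ᵏ`, below the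
  -- cutoff level `2⁻ᵏ`.
  choose p hpsa hpb using fun k : ℕ =>
    M.exists_selfAdjoint_evalPoly_norm_sub_lt x hx hb (show (0 : ℝ) < (1 / 2) ^ k / 2 by positivity)
  obtain ⟨g, hgsa, hgstep, hgx⟩ := M.exists_lift_of_evalPoly x hxR p hpsa fun k => by
    rw [map_sub, map_sub]
    have h1 := hpb k
    have h2 := hpb (k + 1)
    rw [norm_sub_rev, pow_succ] at h2
    have h3 := norm_sub_le_norm_sub_add_norm_sub (M.toL2 (M.evalPoly x (p (k + 1))))
      (M.toL2 b) (M.toL2 (M.evalPoly x (p k)))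
    have h4 : (0 : ℝ) < (1 / 2) ^ k := by positivity
    linarith
  obtain ⟨f, hf, hflim⟩ := Fun2.exists_tendsto_squash g hgsa hgstep hr
  refine ⟨f, hf, tendsto_nhds_unique (hflim M x hxR) ?_⟩
  have ha : (a : M.Elem) = (r : ℂ) • cfc squash b := by rw [hba, smul_inv_smul₀ hrC]
  rw [ha, tendsto_iff_dist_tendsto_zero]
  refine squeeze_zero (fun _ => dist_nonneg) (fun k => ?_)
    (g := fun k => r * 4 * ((1 / 2 : ℝ) ^ k / 2)) ?_
  · rw [dist_eq_norm]
    refine (M.norm_toL2_smul_squash_sub_le (hgsa _ M x hxR) hb hr.le).trans ?_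
    rw [hgx, norm_sub_rev]
    exact mul_le_mul_of_nonneg_left (hpb k).le (by positivity)
  · have := ((tendsto_pow_atTop_nhds_zero_of_lt_one (r := (1 / 2 : ℝ)) (by norm_num)
      (by norm_num)).div_const 2).const_mul (r * 4)
    simpa using this

/-- Every bounded self-adjoint tuple in `W^*(x)` is the value at `x` of a tuple in `F_{R,R'}`. -/
theorem exists_funTuple_eval_eq {I' : Type u} {R' : I' → ℝ} (x : I → selfAdjoint M.Elem)
    (hx : M.wStar x = M.alg) (hxR : ∀ i, ‖(x i : M.Elem)‖ ≤ R i) (hR' : ∀ i, 0 < R' i)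
    (y : I' → selfAdjoint M.Elem) (hyR' : ∀ i, ‖(y i : M.Elem)‖ ≤ R' i) :
    ∃ f : FunTuple R R', f.eval M x hxR = y := by
  choose f hf hfy using fun i => M.exists_fun2_eval_eq x hx hxR (y i) (hR' i) (hyR' i)
  refine ⟨⟨f, hf⟩, funext fun i => Subtype.ext (M.toL2_injective ?_)⟩
  exact (FunTuple.toL2_eval ⟨f, hf⟩ M x hxR i).trans (hfy i)

end TracialWStarAlgebra

/-! ### Conclusion. -/

/-- With `y = f(x)`, the push-forward is taken with the same `M` and `P`; no commuting square
condition enters. -/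
lemma IsRandomMatrixModel.exists_of_generators {I I' : Type u} {M : TracialWStarAlgebra.{u}}
    {P : VonNeumannAlgebra M.H} {x : I → selfAdjoint M.Elem} (hx : M.wStar x = M.alg)
    {R : I → ℝ} (hxR : ∀ i, ‖(x i : M.Elem)‖ ≤ R i) {R' : I' → ℝ} (hR' : ∀ i, 0 < R' i)
    {n : ℕ → ℕ} [∀ k, NeZero (n k)] {y : I' → selfAdjoint M.Elem}
    (hyR' : ∀ i, ‖(y i : M.Elem)‖ ≤ R' i)
    (h : ∃ μ : ∀ k, Measure (MatTuple I (n k)), IsRandomMatrixModel M P x R n μ) :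
    ∃ ν : ∀ k, Measure (MatTuple I' (n k)), IsRandomMatrixModel M P y R' n ν := by
  obtain ⟨μ, hμ⟩ := h
  obtain ⟨f, rfl⟩ := M.exists_funTuple_eval_eq x hx hxR hR' y hyR'
  exact ⟨_, hμ.pushforward hxR f P _ (fun _ => rfl) fun _ => rfl⟩

theorem mainTheorem10 {I I' : Type u} (M : TracialWStarAlgebra.{u})
    (P : VonNeumannAlgebra M.H) (hP : P ≤ M.alg)
    (x : I → selfAdjoint M.Elem) (hx : M.wStar x = M.alg)
    (R : I → ℝ) (hR : ∀ i, 0 < R i) (hxR : ∀ i, ‖(x i : M.Elem)‖ ≤ R i)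
    (R' : I' → ℝ) (hR' : ∀ i, 0 < R' i)
    (n : ℕ → ℕ) [∀ k, NeZero (n k)] (hn : Tendsto n atTop atTop) :
    (∀ (f : FunTuple R R') (y : I' → selfAdjoint M.Elem), y = f.eval M x hxR →
      (∀ a : M.Elem, M.condExp P (M.condExp (M.wStar y) (M.toL2 a)) =
        M.condExp (P.inter (M.wStar y)) (M.toL2 a)) →
      ∀ μ : ∀ k, Measure (MatTuple I (n k)), IsRandomMatrixModel M P x R n μ →
        IsRandomMatrixModel (M.generated y) (P.inter (M.wStar y)) (M.generators y) R' n
          (fun k => MatTuple.pushforward f (μ k))) ∧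
    (∀ y : I' → selfAdjoint M.Elem, M.wStar y = M.alg → (∀ i, ‖(y i : M.Elem)‖ ≤ R' i) →
      ((∃ μ : ∀ k, Measure (MatTuple I (n k)), IsRandomMatrixModel M P x R n μ) ↔
        ∃ ν : ∀ k, Measure (MatTuple I' (n k)), IsRandomMatrixModel M P y R' n ν)) := by
  refine ⟨?_, fun y hy hyR' => ⟨fun h => IsRandomMatrixModel.exists_of_generators hx hxR hR' hyR' h,
    fun h => IsRandomMatrixModel.exists_of_generators hy hyR' hR hxR h⟩⟩
  rintro f y rfl hE μ hμ
  set y := f.eval M x hxR with hy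
  refine hμ.pushforward hxR f _ _ (fun q => ?_) fun q => ?_
  · rw [← M.incl_evalPoly_generators y q]
    rfl
  -- The norm of `E_{P∩Q}[q(y)]` is the same in `L²(Q)` and `L²(M)`. There `E_{P∩Q} = E_P E_Q`, and
  -- `E_Q` fixes `q(y)`.
  · have h1 := M.norm_condExp_sub (M.wStar y) (M.wStar_le y) (P.inter (M.wStar y))
      (fun _ h => h.2) ((M.generated y).evalPoly (M.generators y) q)
    rw [M.incl_evalPoly_generators, ← hE, M.condExp_of_mem _ _ (M.evalPoly_mem_wStar y q)] at h1
    exact h1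

end
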